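/- For an oracle $A:\{0,1\}^*\to\{0,1\}$ define the following classes of languages $L\subseteq\{0,1\}^*$. * $\mathsf{SBP}^A$: there are a probabilistic machine $M$ with oracle access to $A$, halting on every input $x$ and all coin outcomes within a number of steps polynomial in $|x|$, and a polynomial $\sigma$ with coefficients in $\mathbb{N}$, such that $\Pr[M^A(x)\text{ accepts}]\ge 2^{-\sigma(|x|)}$ for all $x\in L$ and $\Pr[M^A(x)\text{ accepts}]\le 2^{-\sigma(|x|)}/2$ for all $x\notin L$. * $\mathsf{SBQP}^A$: the same, with a polynomial-time uniform family $(C_n)_{n\in\mathbb{N}}$ of quantum circuits in place of $M$. The circuit $C_n$ consists of Hadamard gates, gates $\mathrm{diag}(1,e^{i\pi/4})$, controlled NOT gates and oracle gates $|y\rangle|b\rangle\mapsto|y\rangle|b\oplus A(y)\rangle$; a deterministic machine without oracle computes a description of $C_n$ from $1^n$ in time polynomial in $n$. On input $x$ the circuit $C_{|x|}$ is run on $|x\rangle|0\cdots0\rangle$, and accepts if measuring its output qubit gives $1$. * $\mathsf{QMA}^A$: there are such a uniform family $(C_n)_{n\in\mathbb{N}}$ and a polynomial $m$ such that, when $C_{|x|}$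 is run on $|x\rangle|\psi\rangle|0\cdots0\rangle$ for a state $\psi$ of $m(|x|)$ qubits, then for every $x\in L$ some $\psi$ is accepted with probability at least $2/3$, and for every $x\notin L$ every $\psi$ is accepted with probability at most $1/3$. **Corollary 3.4.** There exist an oracle $A:\{0,1\}^*\to\{0,1\}$ and two languages $L_0,L_1\subseteq\{0,1\}^*$ such that 1. $L_0,L_1\in\mathsf{SBP}^A$; 2. $L_0\cap L_1\notin\mathsf{SBQP}^A$; 3. $\mathsf{SBP}^A\not\subseteq\mathsf{QMA}^A$; 4. $\mathsf{SBP}^A$ is not closed under intersection. -/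

import Mathlib

namespace Relativized

/-! ## Classical machines with an oracle and fair coins -/

/-- An oracle is an arbitrary function from finite bit strings to bits. -/
abbrev Oracle : Type := List Bool → Bool

/-- The elementary instructions of a machine with `k + 2` stacks and `s + 1` control states.
`push i b q`: push `b` on stack `i` and go to state `q`.
`pop i q`: pop stack `i` and go to the state `q o`, where `o` is the popped bit (or `none` if the
stack was empty).
`toss q`: toss a fair coin and go to the state `q b`, where `b` is the outcome.
`query q`: ask the oracle about the bit string on stack `1` and go to the state `q b`, where `b` is
the answer.
`halt b`: stop, accepting if `b = true` and rejecting if `b = false`. -/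
inductive Instr (k s : ℕ) : Type
  | push (i : Fin (k + 2)) (b : Bool) (q : Fin (s + 1)) : Instr k s
  | pop (i : Fin (k + 2)) (q : Option Bool → Fin (s + 1)) : Instr k s
  | toss (q : Bool → Fin (s + 1)) : Instr k s
  | query (q : Bool → Fin (s + 1)) : Instr k s
  | halt (b : Bool) : Instr k s

/-- A probabilistic oracle machine with finite control and finitely many stacks of bits (a Turing
tape is a pair of stacks). Stack `0` holds the input and the output, stack `1` is the query stack,
the others are work stacks. The computation starts in state `0`. -/
structure Machine : Type where
  /-- the number of work stacks -/
  work : ℕ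
  /-- the number of control states other than the start state -/
  states : ℕ
  /-- the instruction to carry out in each control state -/
  prog : Fin (states + 1) → Instr work states

/-- A configuration: the control state and the contents of the stacks, top first. -/
structure Machine.Cfg (M : Machine) : Type where
  /-- the control state -/
  state : Fin (M.states + 1)
  /-- the contents of the stacks -/
  stk : Fin (M.work + 2) → List Bool

/-- The start configuration: the input is on stack `0`, its first bit on top; all other stacks are
empty. -/
def Machine.start (M : Machine) (x : List Bool) : M.Cfg :=
  ⟨0, fun i => if i = 0 then x else []⟩

/-- One step with oracle `A`, where `coin` is the outcome of the coin if one is tossed in this step.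
Halted configurations do not change. -/
def Machine.step (M : Machine) (A : Oracle) (coin : Bool) (c : M.Cfg) : M.Cfg :=
  match M.prog c.state with
  | .push i b q => ⟨q, Function.update c.stk i (b :: c.stk i)⟩
  | .pop i q => ⟨q (c.stk i).head?, Function.update c.stk i (c.stk i).tail⟩
  | .toss q => ⟨q coin, c.stk⟩
  | .query q => ⟨q (A (c.stk 1)), c.stk⟩
  | .halt _ => c

/-- The configuration after `T` steps on input `x` with oracle `A`, where `r t` is the outcome of
the coin in step `t`, if one is tossed in that step. -/
def Machine.run (M : Machine) (A : Oracle) (x : List Bool) {T : ℕ} (r : Fin T → Bool) : M.Cfg :=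
  (List.ofFn r).foldl (fun c b => M.step A b c) (M.start x)

/-- `some b` if the configuration is halted with verdict `b`, and `none` if it is not halted. -/
def Machine.verdict (M : Machine) (c : M.Cfg) : Option Bool :=
  match M.prog c.state with
  | .halt b => some b
  | _ => none

/-- With oracle `A`, the machine halts on every input `x` within `p (|x|)` steps, whatever the
outcomes of the coins. -/
def Machine.RunsInTime (M : Machine) (A : Oracle) (p : Polynomial ℕ) : Prop :=
  ∀ (x : List Bool) (r : Fin (p.eval x.length) → Bool), (M.verdict (M.run A x r)).isSome = true

/-- The probability, over `T` independent fair coins, that the machine has accepted the input `x`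
after `T` steps with oracle `A`. -/
noncomputable def Machine.acceptProb (M : Machine) (A : Oracle) (x : List Bool) (T : ℕ) : ℝ :=
  ((Finset.univ.filter fun r : Fin T → Bool => M.verdict (M.run A x r) = some true).card : ℝ)
    / 2 ^ T

/-- The class `SBP` relative to the oracle `A`. -/
def SBP (A : Oracle) : Set (Language Bool) :=
  {L | ∃ (M : Machine) (p σ : Polynomial ℕ), M.RunsInTime A p ∧
    ∀ x : List Bool,
      (x ∈ L → (2 ^ σ.eval x.length : ℝ)⁻¹ ≤ M.acceptProb A x (p.eval x.length)) ∧
      (x ∉ L → M.acceptProb A x (p.eval x.length) ≤ (2 ^ σ.eval x.length : ℝ)⁻¹ / 2)}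

/-! ## Quantum circuits with oracle gates -/

/-- Gates on `n` qubits: the universal set consisting of the Hadamard gate, the `π/8` gate
`diag(1, exp(iπ/4))` and the controlled NOT, together with oracle gates, which read the qubits
listed in `q` (in this order) as a bit string and flip the target `t` if the oracle contains it. -/
inductive Gate (n : ℕ) : Type
  | hadamard (i : Fin n) : Gate n
  | phase (i : Fin n) : Gate n
  | cnot (c t : Fin n) (h : c ≠ t) : Gate n
  | oracle (q : List (Fin n)) (t : Fin n) (h : (t :: q).Nodup) : Gate n

/-- Amplitudes of a state of `n` qubits in the computational basis. -/
abbrev QState (n : ℕ) : Type := (Fin n → Bool) → ℂ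

/-- The action of a gate on states. -/
noncomputable def Gate.apply {n : ℕ} (A : Oracle) (g : Gate n) (v : QState n) : QState n :=
  match g with
  | .hadamard i => fun y =>
      (v (Function.update y i false)
        + (if y i = true then -1 else 1) * v (Function.update y i true)) / (Real.sqrt 2 : ℂ)
  | .phase i => fun y =>
      (if y i = true then Complex.exp (Complex.I * (Real.pi / 4)) else 1) * v y
  | .cnot c t _ => fun y => v (Function.update y t (xor (y t) (y c)))
  | .oracle q t _ => fun y => v (Function.update y t (xor (y t) (A (q.map y))))

/-- A quantum circuit on `k + 1` qubits (`k` is the field `extra`): a list of gates, applied from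
left to right. The output qubit is qubit `0`. -/
structure QCircuit : Type where
  /-- the number of qubits besides the output qubit -/
  extra : ℕ
  /-- the gates -/
  gates : List (Gate (extra + 1))

/-- The final state of a circuit on a given initial state. -/
noncomputable def QCircuit.eval (C : QCircuit) (A : Oracle) (v : QState (C.extra + 1)) :
    QState (C.extra + 1) :=
  C.gates.foldl (fun u g => g.apply A u) v

/-- The probability that measuring the output qubit in the final state gives `1`. -/
noncomputable def QCircuit.acceptProb (C : QCircuit) (A : Oracle) (v : QState (C.extra + 1)) : ℝ :=
  ∑ y : Fin (C.extra + 1) → Bool, if y 0 = true then ‖C.eval A v y‖ ^ 2 else 0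

/-- The unit vectors `|x⟩ ⊗ |ψ⟩ ⊗ |0⋯0⟩` with `ψ` a state of `m` qubits: the first `|x|` qubits
are in the basis state `x`, the following `m` qubits are arbitrary, all others are zero. -/
def IsInitialState {n : ℕ} (x : List Bool) (m : ℕ) (v : QState n) : Prop :=
  ∑ y, ‖v y‖ ^ 2 = 1 ∧
    ∀ y, v y ≠ 0 → ∀ i : Fin n,
      (∀ h : i.val < x.length, y i = x[i.val]) ∧ (x.length + m ≤ i.val → y i = false)

/-- The basis state `|x⟩ ⊗ |0⋯0⟩`. -/
def ket (n : ℕ) (x : List Bool) : QState n :=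
  fun y => if (∀ i : Fin n, y i = x.getD i.val false) then 1 else 0

/-! ## Uniform circuit families -/

/-- The unary code of a natural number. -/
def unary (n : ℕ) : List Bool := List.replicate n true ++ [false]

/-- The code of a gate. -/
def Gate.code {n : ℕ} : Gate n → List Bool
  | .hadamard i => unary 0 ++ unary i.val
  | .phase i => unary 1 ++ unary i.val
  | .cnot c t _ => unary 2 ++ unary c.val ++ unary t.val
  | .oracle q t _ => unary 3 ++ unary q.length ++ q.flatMap (fun i => unary i.val) ++ unary t.val

/-- The code of a circuit: the number of its qubits and then its gates. -/
def QCircuit.code (C : QCircuit) : List Bool :=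
  unary C.extra ++ C.gates.flatMap Gate.code

theorem unary_append_inj {a b : ℕ} {l l' : List Bool} (h : unary a ++ l = unary b ++ l') :
    a = b ∧ l = l' := by
  induction a generalizing b with
  | zero => cases b <;> simp_all [unary, List.replicate_succ]
  | succ a ih =>
    cases b with
    | zero => simp [unary, List.replicate_succ] at h
    | succ b =>
      have h2 : unary a ++ l = unary b ++ l' := by
        simpa [unary, List.replicate_succ] using h
      obtain ⟨h3, h4⟩ := ih h2
      exact ⟨by rw [h3], h4⟩

theorem flatMap_unary_append_inj {n : ℕ} {q q' : List (Fin n)} {l l' : List Bool}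
    (hq : q.length = q'.length)
    (h : q.flatMap (fun i => unary i.val) ++ l = q'.flatMap (fun i => unary i.val) ++ l') :
    q = q' ∧ l = l' := by
  induction q generalizing q' with
  | nil => cases q' <;> simp_all
  | cons a q ih =>
    cases q' with
    | nil => simp at hq
    | cons b q' =>
      simp only [List.flatMap_cons, List.append_assoc] at h
      obtain ⟨h1, h2⟩ := unary_append_inj h
      obtain ⟨h3, h4⟩ := ih (by simpa using hq) h2
      exact ⟨by rw [Fin.ext h1, h3], h4⟩

theorem Gate.code_append_inj {n : ℕ} {g g' : Gate n} {l l' : List Bool}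
    (h : g.code ++ l = g'.code ++ l') : g = g' ∧ l = l' := by
  cases g <;> cases g' <;> simp only [Gate.code, List.append_assoc] at h <;>
    obtain ⟨h0, h⟩ := unary_append_inj h <;> first | omega | skip
  · obtain ⟨h1, h⟩ := unary_append_inj h
    exact ⟨by rw [Fin.ext h1], h⟩
  · obtain ⟨h1, h⟩ := unary_append_inj h
    exact ⟨by rw [Fin.ext h1], h⟩
  · obtain ⟨h1, h⟩ := unary_append_inj h
    obtain ⟨h2, h3⟩ := unary_append_inj h
    exact ⟨by simp only [Fin.ext h1, Fin.ext h2], h3⟩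
  · obtain ⟨h1, h⟩ := unary_append_inj h
    obtain ⟨h2, h⟩ := flatMap_unary_append_inj h1 h
    obtain ⟨h3, h4⟩ := unary_append_inj h
    exact ⟨by simp only [h2, Fin.ext h3], h4⟩

/-- A circuit is determined by its code. -/
theorem QCircuit.code_injective : Function.Injective QCircuit.code := by
  have key : ∀ (n : ℕ) (gs gs' : List (Gate n)),
      gs.flatMap Gate.code = gs'.flatMap Gate.code → gs = gs' := by
    intro n gs
    have hne : ∀ g : Gate n, g.code ≠ [] := by
      intro g
      cases g <;> simp [Gate.code, unary]
    induction gs with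
    | nil =>
      intro gs' h
      cases gs' with
      | nil => rfl
      | cons g' gs' => simp [List.flatMap_cons, hne] at h
    | cons g gs ih =>
      intro gs' h
      cases gs' with
      | nil => simp [List.flatMap_cons, hne] at h
      | cons g' gs' =>
        simp only [List.flatMap_cons] at h
        obtain ⟨h1, h2⟩ := Gate.code_append_inj h
        rw [h1, ih gs' h2]
  rintro ⟨k, gs⟩ ⟨k', gs'⟩ h
  obtain ⟨h1, h2⟩ := unary_append_inj h
  simp only at h1
  subst h1
  rw [key _ gs gs' h2]

/-- The machine is deterministic and oracle-free: it tosses no coins and asks no queries. -/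
def Machine.IsPlain (M : Machine) : Prop :=
  ∀ s, (∀ q, M.prog s ≠ .toss q) ∧ (∀ q, M.prog s ≠ .query q)

/-- The family `C` is polynomial-time uniform: a deterministic machine without oracle writes the
code of `C n` on stack `0` and halts within `p n` steps on input `1ⁿ`, for a polynomial `p`. (The
oracle and the coin outcomes supplied to `run` are immaterial as the machine does not use them.) -/
def PolyTimeUniform (C : ℕ → QCircuit) : Prop :=
  ∃ (M : Machine) (p : Polynomial ℕ), M.IsPlain ∧
    ∀ n : ℕ,
      let c := M.run (fun _ => false) (List.replicate n true) (fun _ : Fin (p.eval n) => false)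
      (M.verdict c).isSome = true ∧ c.stk 0 = (C n).code

/-- The class `SBQP` relative to the oracle `A`: as `SBP`, with uniform families of quantum circuits
in place of probabilistic machines. -/
def SBQP (A : Oracle) : Set (Language Bool) :=
  {L | ∃ (C : ℕ → QCircuit) (σ : Polynomial ℕ), PolyTimeUniform C ∧
    ∀ x : List Bool,
      (x ∈ L → (2 ^ σ.eval x.length : ℝ)⁻¹ ≤ (C x.length).acceptProb A (ket _ x)) ∧
      (x ∉ L → (C x.length).acceptProb A (ket _ x) ≤ (2 ^ σ.eval x.length : ℝ)⁻¹ / 2)}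

/-- The class `QMA` relative to the oracle `A`: a uniform family of quantum circuits verifies a
quantum witness of polynomially many qubits, with completeness and soundness errors `1/3`. -/
def QMA (A : Oracle) : Set (Language Bool) :=
  {L | ∃ (C : ℕ → QCircuit) (m : Polynomial ℕ), PolyTimeUniform C ∧
    ∀ x : List Bool,
      (x ∈ L → ∃ v, IsInitialState x (m.eval x.length) v ∧
        2 / 3 ≤ (C x.length).acceptProb A v) ∧
      (x ∉ L → ∀ v, IsInitialState x (m.eval x.length) v →
        (C x.length).acceptProb A v ≤ 1 / 3)}

end Relativized

/-! The languages are `countLanguage A b` for the two bits `b`: an input of length `n` belongs to it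
when `A` contains at least `2 ^ n` of the `4 ^ n` strings `b y` with `|y| = 2n`. The oracle keeps a
promise: each such count is at least `2 ^ n` or at most half of that. Hence accepting when a
uniformly random `b y` lies in `A` is an SBP algorithm with threshold `2 ^ (-n)`.

The intersection is hard by the polynomial method. The acceptance probability of an efficient
algorithm is a polynomial in the oracle bits of polynomially bounded degree `d`. Redraw the strings
of the two blocks independently, with probabilities `θ * t` and `θ / t` where `θ = 2 / 2 ^ n`, and
add the mean with the two blocks exchanged. The sum is invariant under `t ↦ 1 / t`, so it is a
polynomial `Q` of degree at most `d` in `s = t + 1 / t` (`exists_polynomial_blockMean`). At `s = 2`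
both counts are large with overwhelming probability, and `Q` is at least nearly `2α` for the
acceptance threshold `α`. For `t ≥ 8` one count is small, so `Q` stays between `0` and about `α` for
`s` from `65 / 8` to `2 ^ n / 2`. By Chebyshev extremality (`eval_le_cosh_one`) a polynomial bounded
on so long an interval cannot grow that much within a constant distance of it, unless `d` is of
order `2 ^ (n / 2)`. This is `exists_not_separates`.

If SBP were contained in QMA, both count languages would have verifiers. The product of the traces
of the `k`-th powers of their acceptance operators is again a low-degree polynomial, and for
suitable `k` it separates the intersection from its complement by a factor of 2 (`le_pairTrace`,
`pairTrace_le`), so the same lower bound applies.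

One oracle defeats all algorithms by Baire category: among the oracles that keep the promise, those
on which a given algorithm fails at some input `1ⁿ` form an open set, and a dense one because every
oracle can be spoiled at arbitrarily large `n`. There are only countably many algorithms
(`exists_oracle_forall_not_separates`). -/

namespace Relativized

open Polynomial

/-! ## Polynomials in the bits of the oracle -/

/-- The product of the bits of the oracle at the strings in `S`. -/
def bitMonomial (𝕜 : Type*) [Field 𝕜] (S : Finset (List Bool)) : Oracle → 𝕜 :=
  fun A => ∏ u ∈ S, if A u = true then 1 else 0

/-- The functions of the oracle that are polynomials of degree at most `d` in its bits. -/
def degreeLE (𝕜 : Type*) [Field 𝕜] (d : ℕ) : Submodule 𝕜 (Oracle → 𝕜) :=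
  Submodule.span 𝕜 (bitMonomial 𝕜 '' {S | S.card ≤ d})

section Degree

variable {𝕜 : Type*} [Field 𝕜]

theorem bitMonomial_mem {d : ℕ} {S : Finset (List Bool)} (h : S.card ≤ d) :
    bitMonomial 𝕜 S ∈ degreeLE 𝕜 d :=
  Submodule.subset_span ⟨S, h, rfl⟩

theorem degreeLE_mono {d e : ℕ} (h : d ≤ e) : degreeLE 𝕜 d ≤ degreeLE 𝕜 e :=
  Submodule.span_mono (Set.image_mono fun _ hS => le_trans hS h)

theorem one_mem_degreeLE (d : ℕ) : (1 : Oracle → 𝕜) ∈ degreeLE 𝕜 d := by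
  have h : bitMonomial 𝕜 ∅ = 1 := by ext; simp [bitMonomial]
  exact h ▸ bitMonomial_mem (by simp)

theorem const_mem_degreeLE (d : ℕ) (c : 𝕜) : (fun _ => c : Oracle → 𝕜) ∈ degreeLE 𝕜 d := by
  have h : (fun _ => c : Oracle → 𝕜) = c • (1 : Oracle → 𝕜) := by ext; simp
  exact h ▸ Submodule.smul_mem _ _ (one_mem_degreeLE d)

theorem bit_mem_degreeLE (u : List Bool) :
    (fun A : Oracle => if A u = true then (1 : 𝕜) else 0) ∈ degreeLE 𝕜 1 := by
  have h : bitMonomial 𝕜 {u} = fun A : Oracle => if A u = true then (1 : 𝕜) else 0 := by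
    ext; simp [bitMonomial]
  exact h ▸ bitMonomial_mem (by simp)

theorem bitMonomial_mul (S T : Finset (List Bool)) :
    bitMonomial 𝕜 S * bitMonomial 𝕜 T = bitMonomial 𝕜 (S ∪ T) := by
  ext A
  simp only [Pi.mul_apply, bitMonomial, Finset.prod_ite_zero, Finset.prod_const_one,
    ite_zero_mul_ite_zero, mul_one]
  exact if_congr (by simp only [Finset.mem_union, or_imp, forall_and]) rfl rfl

theorem mul_mem_degreeLE {d e : ℕ} {f g : Oracle → 𝕜} (hf : f ∈ degreeLE 𝕜 d)
    (hg : g ∈ degreeLE 𝕜 e) : f * g ∈ degreeLE 𝕜 (d + e) := by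
  have h := Submodule.mul_mem_mul hf hg
  rw [degreeLE, degreeLE, Submodule.span_mul_span] at h
  refine Submodule.span_mono ?_ h
  rintro _ ⟨_, ⟨S, hS, rfl⟩, _, ⟨T, hT, rfl⟩, rfl⟩
  exact ⟨S ∪ T, (Finset.card_union_le S T).trans (Nat.add_le_add hS hT), (bitMonomial_mul S T).symm⟩

/-- A function that branches on one oracle bit. -/
theorem ite_mem_degreeLE {d : ℕ} (u : List Bool) {f g : Oracle → 𝕜} (hf : f ∈ degreeLE 𝕜 d)
    (hg : g ∈ degreeLE 𝕜 d) :
    (fun A => if A u = true then f A else g A) ∈ degreeLE 𝕜 (d + 1) := by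
  have h := add_mem (mul_mem_degreeLE (sub_mem hf hg) (bit_mem_degreeLE u))
    (degreeLE_mono (Nat.le_succ d) hg)
  convert h using 1
  ext A
  by_cases hA : A u = true <;> simp [hA]

end Degree

/-- Monomials are real valued, but complex scalars mix real and imaginary parts, so the induction
carries both. -/
theorem re_mem_degreeLE {d : ℕ} {f : Oracle → ℂ} (hf : f ∈ degreeLE ℂ d) :
    (fun A => (f A).re) ∈ degreeLE ℝ d := by
  suffices h : (fun A => (f A).re) ∈ degreeLE ℝ d ∧ (fun A => (f A).im) ∈ degreeLE ℝ d from h.1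
  induction hf using Submodule.span_induction with
  | mem f hf =>
    obtain ⟨S, hS, rfl⟩ := hf
    have h : ∀ A, bitMonomial ℂ S A = ((bitMonomial ℝ S A : ℝ) : ℂ) := fun A => by
      simp only [bitMonomial, Complex.ofReal_prod]
      exact Finset.prod_congr rfl fun u _ => by split <;> simp
    simp only [h, Complex.ofReal_re, Complex.ofReal_im]
    exact ⟨bitMonomial_mem hS, zero_mem _⟩
  | zero => exact ⟨zero_mem _, zero_mem _⟩
  | add f g _ _ hf hg => exact ⟨add_mem hf.1 hg.1, add_mem hf.2 hg.2⟩
  | smul c f _ hf =>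
    simp only [Pi.smul_apply, smul_eq_mul, Complex.mul_re, Complex.mul_im]
    exact ⟨sub_mem (Submodule.smul_mem _ c.re hf.1) (Submodule.smul_mem _ c.im hf.2),
      add_mem (Submodule.smul_mem _ c.re hf.2) (Submodule.smul_mem _ c.im hf.1)⟩

theorem conj_mem_degreeLE {d : ℕ} {f : Oracle → ℂ} (hf : f ∈ degreeLE ℂ d) :
    (fun A => star (f A)) ∈ degreeLE ℂ d := by
  induction hf using Submodule.span_induction with
  | mem f hf =>
    obtain ⟨S, hS, rfl⟩ := hf
    have h : (fun A => star (bitMonomial ℂ S A)) = bitMonomial ℂ S := by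
      ext A
      simp only [bitMonomial, Finset.prod_ite_zero, Finset.prod_const_one]
      split <;> simp
    rw [h]
    exact bitMonomial_mem hS
  | zero =>
    simp only [Pi.zero_apply, star_zero]
    exact zero_mem _
  | add f g _ _ hf hg => 
    simp only [Pi.add_apply, star_add]
    exact add_mem hf hg
  | smul c f _ hf => simpa [Pi.smul_def, mul_comm] using Submodule.smul_mem _ (star c) hf

/-- Such a function depends on finitely many bits only, and oracles carry the product topology. This
supplies openness in the Baire argument. -/
theorem continuous_of_mem_degreeLE {d : ℕ} {f : Oracle → ℝ} (hf : f ∈ degreeLE ℝ d) :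
    Continuous f := by
  induction hf using Submodule.span_induction with
  | mem f hf =>
    obtain ⟨S, -, rfl⟩ := hf
    refine continuous_finsetProd _ fun u _ => ?_
    exact (continuous_of_discreteTopology (f := fun b : Bool => if b = true then (1 : ℝ) else 0)).comp
      (continuous_apply u)
  | zero => exact continuous_const
  | add f g _ _ hf hg => exact hf.add hg
  | smul c f _ hf => exact hf.const_smul c

/-! ## Random oracles -/

/-- The oracle which is `t` on `B` and `A` elsewhere. -/
def overwrite (A : Oracle) (B t : Finset (List Bool)) : Oracle :=
  fun u => if u ∈ B then decide (u ∈ t) else A u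

/-- The mean of `F` if the bits of `A` at the strings `u ∈ B` are replaced by independent random
bits that are `true` with probability `p u`. -/
noncomputable def bernoulliMean (A : Oracle) (B : Finset (List Bool)) (p : List Bool → ℝ)
    (F : Oracle → ℝ) : ℝ :=
  ∑ t ∈ B.powerset, ((∏ u ∈ t, p u) * ∏ u ∈ B \ t, (1 - p u)) * F (overwrite A B t)

section Mean

variable (A : Oracle) (B : Finset (List Bool)) (p : List Bool → ℝ)

/-- Independence: the mean of a product of functions of single bits is the product of their means,
here the expansion of a product of sums over subsets. -/
theorem bernoulliMean_of_prod {F : Oracle → ℝ} (c : ℝ) (g h : List Bool → ℝ)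
    (hF : ∀ t ⊆ B, F (overwrite A B t) = c * ∏ u ∈ B, if u ∈ t then g u else h u) :
    bernoulliMean A B p F = c * ∏ u ∈ B, (p u * g u + (1 - p u) * h u) := by
  rw [Finset.prod_add, Finset.mul_sum]
  refine Finset.sum_congr rfl fun t ht => ?_
  have ht := Finset.mem_powerset.1 ht
  rw [hF t ht, ← Finset.prod_sdiff ht, Finset.prod_congr rfl fun u hu => if_pos hu,
    Finset.prod_congr (rfl : B \ t = B \ t) fun u hu => if_neg (Finset.mem_sdiff.1 hu).2,
    Finset.prod_mul_distrib, Finset.prod_mul_distrib]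
  ring

theorem bernoulliMean_const (c : ℝ) : bernoulliMean A B p (fun _ => c) = c := by
  rw [bernoulliMean_of_prod A B p c (fun _ => 1) (fun _ => 1) (by simp)]
  simp

theorem bernoulliMean_add (F G : Oracle → ℝ) :
    bernoulliMean A B p (F + G) = bernoulliMean A B p F + bernoulliMean A B p G := by
  simp only [bernoulliMean, Pi.add_apply, mul_add, Finset.sum_add_distrib]

theorem bernoulliMean_smul (c : ℝ) (F : Oracle → ℝ) :
    bernoulliMean A B p (c • F) = c * bernoulliMean A B p F := by
  simp only [bernoulliMean, Pi.smul_apply, smul_eq_mul, Finset.mul_sum]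
  exact Finset.sum_congr rfl fun t _ => by ring

variable {A B p}

theorem bernoulliMean_le {F G : Oracle → ℝ} (hp : ∀ u, 0 ≤ p u ∧ p u ≤ 1)
    (h : ∀ t ⊆ B, F (overwrite A B t) ≤ G (overwrite A B t)) :
    bernoulliMean A B p F ≤ bernoulliMean A B p G := by
  refine Finset.sum_le_sum fun t ht => mul_le_mul_of_nonneg_left (h t (Finset.mem_powerset.1 ht)) ?_
  exact mul_nonneg (Finset.prod_nonneg fun u _ => (hp u).1)
    (Finset.prod_nonneg fun u _ => sub_nonneg.2 (hp u).2)

end Mean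

/-- Redrawn bits contribute their probabilities and the others are read off `A`, so means turn
degree in the oracle bits into degree in the probabilities. -/
theorem bernoulliMean_bitMonomial (A : Oracle) (B : Finset (List Bool)) (p : List Bool → ℝ)
    (S : Finset (List Bool)) :
    bernoulliMean A B p (bitMonomial ℝ S) = bitMonomial ℝ (S \ B) A * ∏ u ∈ B ∩ S, p u := by
  rw [bernoulliMean_of_prod A B p (bitMonomial ℝ (S \ B) A) (fun _ => 1)
    (fun u => if u ∈ S then 0 else 1)]
  · congr 1
    rw [← Finset.prod_ite_mem]
    refine Finset.prod_congr rfl fun u _ => ?_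
    split <;> simp
  · intro t _
    have h1 : bitMonomial ℝ S (overwrite A B t) =
        bitMonomial ℝ (S \ B) A * ∏ u ∈ B ∩ S, if u ∈ t then 1 else 0 := by
      rw [Finset.inter_comm, bitMonomial, ← Finset.prod_sdiff (Finset.inter_subset_left (s₂ := B)),
        Finset.sdiff_inter_self_left]
      congr 1
      · refine Finset.prod_congr rfl fun u hu => ?_
        simp [overwrite, (Finset.mem_sdiff.1 hu).2]
      · refine Finset.prod_congr rfl fun u hu => ?_
        simp [overwrite, (Finset.mem_inter.1 hu).2]
    rw [h1, ← Finset.prod_ite_mem]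
    congr 1
    refine Finset.prod_congr rfl fun u _ => ?_
    split_ifs <;> rfl

/-! ## Symmetrization -/

theorem natDegree_dickson_le {R : Type*} [CommRing R] (k : ℕ) (a : R) :
    ∀ n, (dickson k a n).natDegree ≤ n
  | 0 => by
    rw [dickson_zero]
    have h : (3 - k : R[X]) = C (3 - k : R) := by simp only [map_sub, map_ofNat, map_natCast]
    rw [h, natDegree_C]
  | 1 => by simpa using natDegree_X_le
  | n + 2 => by
    rw [dickson_add_two]
    refine (natDegree_sub_le _ _).trans (max_le ?_ ?_)
    · refine natDegree_mul_le.trans ?_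
      have := natDegree_dickson_le k a (n + 1)
      have := natDegree_X_le (R := R)
      omega
    · refine (natDegree_C_mul_le _ _).trans ?_
      have := natDegree_dickson_le k a n
      omega

theorem exists_prod_eq_pow_mul_pow (R : Finset (List Bool)) :
    ∃ i j, i + j = R.card ∧ ∀ p : Bool → ℝ,
      ∏ u ∈ R, p (u.headD false) = p false ^ i * p true ^ j := by
  induction R using Finset.induction_on with
  | empty => exact ⟨0, 0, by simp⟩
  | insert u R hu ih =>
    obtain ⟨i, j, h, hp⟩ := ih
    rw [Finset.card_insert_of_notMem hu]
    cases hb : u.headD false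
    · refine ⟨i + 1, j, by omega, fun p => ?_⟩
      rw [Finset.prod_insert hu, hp, hb]
      ring
    · refine ⟨i, j + 1, by omega, fun p => ?_⟩
      rw [Finset.prod_insert hu, hp, hb]
      ring

/-- The mean for the probability `p b` at the strings in `B` that start with `b`. -/
noncomputable def blockMean (A : Oracle) (B : Finset (List Bool)) (p : Bool → ℝ)
    (F : Oracle → ℝ) : ℝ :=
  bernoulliMean A B (fun u => p (u.headD false)) F

/-- The probabilities `a` and `b` for the strings that start with `false` and `true`. -/
def pairProb (a b : ℝ) : Bool → ℝ := fun i => if i = true then b else a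

/-- A monomial contributes a multiple of `t ^ i * t⁻¹ ^ j + t⁻¹ ^ i * t ^ j`, which equals `t ^ e +
t⁻¹ ^ e` with `e = |i - j|`. This is the Dickson polynomial of degree `e` evaluated at `t + t⁻¹`. -/
theorem exists_polynomial_blockMean {d : ℕ} {F : Oracle → ℝ} (hF : F ∈ degreeLE ℝ d)
    (A : Oracle) (B : Finset (List Bool)) (θ : ℝ) :
    ∃ Q : ℝ[X], Q.natDegree ≤ d ∧ ∀ t : ℝ, t ≠ 0 →
      Q.eval (t + t⁻¹) = blockMean A B (pairProb (θ * t) (θ * t⁻¹)) F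
        + blockMean A B (pairProb (θ * t⁻¹) (θ * t)) F := by
  induction hF using Submodule.span_induction with
  | mem F hF =>
    obtain ⟨S, hS, rfl⟩ := hF
    obtain ⟨i, j, hij, hp⟩ := exists_prod_eq_pow_mul_pow (B ∩ S)
    have hd : i + j ≤ d :=
      hij.trans_le ((Finset.card_le_card Finset.inter_subset_right).trans hS)
    simp only [blockMean, bernoulliMean_bitMonomial, hp]
    have key : ∃ e : ℕ, e ≤ d ∧ ∀ t : ℝ, t ≠ 0 → t ^ e + (t⁻¹) ^ e
        = t ^ i * (t⁻¹) ^ j + (t⁻¹) ^ i * t ^ j := by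
      rcases le_total i j with h | h
      · obtain ⟨e, rfl⟩ := Nat.exists_eq_add_of_le h
        refine ⟨e, by omega, fun t ht => ?_⟩
        have h1 : t ^ i * (t⁻¹) ^ i = 1 := by rw [← mul_pow, mul_inv_cancel₀ ht, one_pow]
        rw [pow_add, pow_add]
        linear_combination (-t ^ e - (t⁻¹) ^ e) * h1
      · obtain ⟨e, rfl⟩ := Nat.exists_eq_add_of_le h
        refine ⟨e, by omega, fun t ht => ?_⟩
        have h1 : t ^ j * (t⁻¹) ^ j = 1 := by rw [← mul_pow, mul_inv_cancel₀ ht, one_pow]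
        rw [pow_add, pow_add]
        linear_combination (-t ^ e - (t⁻¹) ^ e) * h1
    obtain ⟨e, he, ht⟩ := key
    refine ⟨C (bitMonomial ℝ (S \ B) A * θ ^ (i + j)) * dickson 1 1 e,
      (natDegree_C_mul_le _ _).trans ((natDegree_dickson_le _ _ _).trans he), fun t ht0 => ?_⟩
    rw [eval_mul, eval_C, dickson_one_one_eval_add_inv _ _ (mul_inv_cancel₀ ht0), ht t ht0]
    simp only [pairProb, if_true, Bool.false_eq_true, if_false, mul_pow, pow_add]
    ring
  | zero => exact ⟨0, by simp, fun t _ => by simp [blockMean, bernoulliMean]⟩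
  | add F G _ _ hF hG =>
    obtain ⟨P, hP, hP'⟩ := hF
    obtain ⟨Q, hQ, hQ'⟩ := hG
    refine ⟨P + Q, natDegree_add_le_of_degree_le hP hQ, fun t ht => ?_⟩
    rw [eval_add, hP' t ht, hQ' t ht]
    simp only [blockMean, bernoulliMean_add]
    ring
  | smul c F _ hF =>
    obtain ⟨P, hP, hP'⟩ := hF
    refine ⟨C c * P, (natDegree_C_mul_le _ _).trans hP, fun t ht => ?_⟩
    rw [eval_mul, eval_C, hP' t ht]
    simp only [blockMean, bernoulliMean_smul]
    ring

open Polynomial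

/-! ## Growth of bounded polynomials -/

/-- A polynomial of degree at most `d` with values in `[-1, 1]` on `[a, b]` is at most `cosh 1` at
a point at a distance of `c` to the left of `a`, if `4 * d ^ 2 * c ≤ b - a`. -/
theorem eval_le_cosh_one {P : ℝ[X]} {d : ℕ} (hd : P.natDegree ≤ d) {a b c : ℝ} (hab : a < b)
    (hc : 0 ≤ c) (h : ∀ s, a ≤ s → s ≤ b → |P.eval s| ≤ 1) (hdc : 4 * d ^ 2 * c ≤ b - a) :
    P.eval (a - c) ≤ Real.cosh 1 := by
  have hba : 0 < b - a := sub_pos.2 hab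
  -- The substitution maps `[-1, 1]` onto `[a, b]` with reversed orientation, so that `a - c`
  -- corresponds to a point to the right of `1`.
  set P' : ℝ[X] := P.comp (C ((a + b) / 2) - C ((b - a) / 2) * X) with hP'
  have hev : ∀ x, P'.eval x = P.eval ((a + b) / 2 - (b - a) / 2 * x) := fun x => by simp [hP']
  have hdeg : P'.degree ≤ d := by
    refine degree_le_of_natDegree_le (natDegree_comp_le.trans ?_)
    refine (Nat.mul_le_mul hd ?_).trans (mul_one d).le
    refine (natDegree_sub_le _ _).trans (max_le (by simp) ?_)
    exact (natDegree_C_mul_le _ _).trans natDegree_X_le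
  have hbnd : ∀ x ∈ Set.Icc (-1 : ℝ) 1, |P'.eval x| ≤ 1 := fun x hx => by
    rw [hev]
    refine h _ ?_ ?_ <;> nlinarith [hx.1, hx.2]
  -- Chosen so that `1 + u ^ 2 / 2` is the evaluation point `1 + 2 * c / (b - a)`; the degree
  -- hypothesis says exactly that `d * u ≤ 1`.
  set u : ℝ := 2 * Real.sqrt (c / (b - a)) with hu
  have hu0 : 0 ≤ u := by positivity
  have hu2 : u ^ 2 = 4 * (c / (b - a)) := by
    rw [hu, mul_pow, Real.sq_sqrt (by positivity)]; norm_num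
  have hx : (1 : ℝ) ≤ 1 + 2 * c / (b - a) := by
    have : 0 ≤ 2 * c / (b - a) := by positivity
    linarith
  have hxu : 1 + 2 * c / (b - a) ≤ Real.cosh u := by
    have h1 : u ^ 2 / 2 = 2 * c / (b - a) := by rw [hu2]; ring
    have h2 := Real.cosh_two_mul (u / 2)
    have h3 := Real.cosh_sq (u / 2)
    have h4 : (u / 2) ^ 2 ≤ Real.sinh (u / 2) ^ 2 :=
      pow_le_pow_left₀ (by positivity) (Real.self_le_sinh_iff.2 (by positivity)) 2
    rw [show 2 * (u / 2) = u by ring] at h2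
    nlinarith
  set v : ℝ := Real.arcosh (1 + 2 * c / (b - a)) with hv
  have hcv : Real.cosh v = 1 + 2 * c / (b - a) := Real.cosh_arcosh hx
  have hvu : |v| ≤ |u| := Real.cosh_le_cosh.1 (hcv.trans_le hxu)
  have hdu : |(d : ℝ) * v| ≤ |1| := by
    rw [abs_mul, Nat.abs_cast, abs_one]
    refine (mul_le_mul_of_nonneg_left hvu (by positivity)).trans ?_
    rw [abs_of_nonneg hu0]
    refine (sq_le_one_iff₀ (by positivity)).1 ?_
    rw [mul_pow, hu2, show (d : ℝ) ^ 2 * (4 * (c / (b - a))) = 4 * d ^ 2 * c / (b - a) by ring]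
    exact (div_le_one hba).2 hdc
  -- The case `k = 0` is the extremal property of Chebyshev polynomials outside `[-1, 1]`; then `T_d
  -- (cosh v) = cosh (d * v)`.
  have key := Chebyshev.eval_iterate_derivative_le_of_forall_abs_le_one (k := 0) hx hdeg hbnd
  simp only [Function.iterate_zero, id_eq] at key
  rw [hev, ← hcv, Chebyshev.T_real_cosh, hcv] at key
  have harg : (a + b) / 2 - (b - a) / 2 * (1 + 2 * c / (b - a)) = a - c := by
    field_simp
    ring
  rw [harg] at key
  exact key.trans (Real.cosh_le_cosh.2 (by exact_mod_cast hdu))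

theorem cosh_one_lt : Real.cosh 1 < 2 := by
  rw [Real.cosh_eq, Real.exp_neg]
  have h1 := Real.exp_one_lt_d9
  have h2 : (Real.exp 1)⁻¹ < 1 := inv_lt_one_of_one_lt₀ (by linarith [Real.exp_one_gt_d9])
  linarith

/-! ## Blocks of the oracle and the promise -/

/-- The strings `b y` with `|y| = m`. -/
def block (b : Bool) (m : ℕ) : Finset (List Bool) :=
  Finset.univ.image fun y : Fin m → Bool => b :: List.ofFn y

theorem card_block (b : Bool) (m : ℕ) : (block b m).card = 2 ^ m := by
  rw [block, Finset.card_image_of_injective _ fun y z h => ?_]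
  · simp
  · exact List.ofFn_injective (List.cons_injective h)

theorem mem_block {b : Bool} {m : ℕ} {u : List Bool} :
    u ∈ block b m ↔ u.head? = some b ∧ u.length = m + 1 := by
  simp only [block, Finset.mem_image, Finset.mem_univ, true_and]
  constructor
  · rintro ⟨y, rfl⟩
    simp
  · rintro ⟨h1, h2⟩
    cases u with
    | nil => simp at h1
    | cons a u =>
      simp only [List.head?_cons, Option.some.injEq] at h1
      simp only [List.length_cons, add_left_inj] at h2
      subst h1 h2
      exact ⟨u.get, by rw [List.ofFn_get]⟩

/-- The number of strings of `block b (2 * n)` in the oracle. -/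
def count (A : Oracle) (b : Bool) (n : ℕ) : ℕ :=
  ((block b (2 * n)).filter fun u => A u = true).card

/-- At `n`, each of the two counts is at least `2 ^ n` or at most half of that. -/
def PromiseAt (A : Oracle) (n : ℕ) : Prop :=
  ∀ b, 2 ^ n ≤ count A b n ∨ 2 * count A b n ≤ 2 ^ n

/-- The union of the two blocks. -/
def blocks (n : ℕ) : Finset (List Bool) := block false (2 * n) ∪ block true (2 * n)

theorem block_subset_blocks (b : Bool) (n : ℕ) : block b (2 * n) ⊆ blocks n := by
  cases b
  · exact Finset.subset_union_left
  · exact Finset.subset_union_right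

theorem count_overwrite {A : Oracle} {n : ℕ} {t : Finset (List Bool)} (b : Bool) :
    count (overwrite A (blocks n) t) b n = (block b (2 * n) ∩ t).card := by
  rw [count, ← Finset.filter_mem_eq_inter]
  congr 1
  refine Finset.filter_congr fun u hu => ?_
  simp [overwrite, block_subset_blocks b n hu]

theorem count_overwrite_of_ne {A : Oracle} {n m : ℕ} {t : Finset (List Bool)} (b : Bool)
    (h : n ≠ m) : count (overwrite A (blocks n) t) b m = count A b m := by
  rw [count, count]
  congr 1
  refine Finset.filter_congr fun u hu => ?_
  have hu' : u ∉ blocks n := fun hn => by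
    have h1 := (mem_block.1 hu).2
    rcases Finset.mem_union.1 hn with h2 | h2 <;> have h2 := (mem_block.1 h2).2 <;> omega
  simp [overwrite, hu']

/-- The generating function of the count. -/
theorem blockMean_pow_count (A : Oracle) (n : ℕ) (p : Bool → ℝ) (b : Bool) (z : ℝ) :
    blockMean A (blocks n) p (fun A => z ^ count A b n) = (1 - p b + p b * z) ^ 4 ^ n := by
  rw [blockMean, bernoulliMean_of_prod A (blocks n) _ 1
    (fun u => if u ∈ block b (2 * n) then z else 1) (fun _ => 1)]
  · have h1 : ∀ u ∈ blocks n,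
        p (u.headD false) * (if u ∈ block b (2 * n) then z else 1)
          + (1 - p (u.headD false)) * 1 = if u ∈ block b (2 * n) then 1 - p b + p b * z else 1 := by
      intro u _
      split_ifs with hu
      · have h2 := (mem_block.1 hu).1
        have h3 : u.headD false = b := by
          obtain ⟨v, rfl⟩ := List.head?_eq_some_iff.1 h2
          rfl
        rw [h3]; ring
      · ring
    rw [one_mul, Finset.prod_congr rfl h1, Finset.prod_ite_mem,
      Finset.inter_eq_right.2 (block_subset_blocks b n), Finset.prod_const, card_block, pow_mul]
    norm_num
  · intro t ht
    rw [count_overwrite, one_mul, ← Finset.prod_const, ← Finset.inter_eq_right.2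
      (Finset.inter_subset_left.trans (block_subset_blocks b n) : block b (2 * n) ∩ t ⊆ _),
      ← Finset.prod_ite_mem]
    refine Finset.prod_congr rfl fun u _ => ?_
    by_cases h1 : u ∈ t <;> by_cases h2 : u ∈ block b (2 * n) <;> simp [h1, h2]

/-- The tail bound for the mean `2 * 2 ^ n` of the count. -/
theorem blockMean_low_tail (A : Oracle) (n : ℕ) {p : Bool → ℝ} {b : Bool}
    (h1 : 2 / 2 ^ n ≤ p b) (h2 : p b ≤ 1) :
    blockMean A (blocks n) p ((2 ^ 2 ^ n : ℝ) • fun A => (1 / 2 : ℝ) ^ count A b n)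
      ≤ Real.exp (-2 ^ n / 20) := by
  rw [blockMean, bernoulliMean_smul, ← blockMean, blockMean_pow_count]
  have hw : (0 : ℝ) < 2 ^ n := by positivity
  have h3 : 1 - p b + p b * (1 / 2) ≤ Real.exp (-(1 / 2 ^ n)) := by
    have h4 := Real.add_one_le_exp (-(1 / 2 ^ n : ℝ))
    have h5 : (2 : ℝ) / 2 ^ n = 2 * (1 / 2 ^ n) := by ring
    linarith
  have h0 : 0 ≤ 1 - p b + p b * (1 / 2) := by
    have : (0 : ℝ) < 2 / 2 ^ n := by positivity
    linarith
  -- With `19 / 20 > log 2` the total exponent is `(19 / 20 - 1) * 2 ^ n`.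
  have h6 : (2 : ℝ) ≤ Real.exp (19 / 20) := by
    have := Real.log_two_lt_d9
    rw [← Real.log_le_iff_le_exp (by norm_num)]
    linarith
  calc (2 : ℝ) ^ 2 ^ n * (1 - p b + p b * (1 / 2)) ^ 4 ^ n
      ≤ Real.exp (19 / 20) ^ 2 ^ n * Real.exp (-(1 / 2 ^ n)) ^ 4 ^ n := by
        gcongr
    _ = Real.exp (-2 ^ n / 20) := by
        rw [← Real.exp_nat_mul, ← Real.exp_nat_mul, ← Real.exp_add]
        congr 1
        push_cast
        rw [show (4 : ℝ) ^ n = 2 ^ n * 2 ^ n by rw [← mul_pow]; norm_num]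
        field_simp
        ring

/-- The tail bound for the mean `2 ^ n / 4` of the count. -/
theorem blockMean_high_tail (A : Oracle) {n : ℕ} (hn : n ≠ 0) {p : Bool → ℝ} {b : Bool}
    (h1 : 0 ≤ p b) (h2 : p b ≤ 1 / 4 / 2 ^ n) :
    blockMean A (blocks n) p (((1 / 2 : ℝ) ^ 2 ^ (n - 1)) • fun A => (2 : ℝ) ^ count A b n)
      ≤ Real.exp (-2 ^ n / 20) := by
  rw [blockMean, bernoulliMean_smul, ← blockMean, blockMean_pow_count]
  have hw : (0 : ℝ) < 2 ^ n := by positivity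
  have h3 : 1 - p b + p b * 2 ≤ Real.exp (1 / 4 / 2 ^ n) := by
    have h4 := Real.add_one_le_exp (1 / 4 / 2 ^ n : ℝ)
    linarith
  have h0 : 0 ≤ 1 - p b + p b * 2 := by linarith
  -- With `3 / 5 < log 2` the total exponent is `(-(3 / 5) / 2 + 1 / 4) * 2 ^ n`, again `-2 ^ n /
  -- 20`.
  have h6 : (1 / 2 : ℝ) ≤ Real.exp (-(3 / 5)) := by
    have := Real.log_two_gt_d9
    rw [← Real.log_le_iff_le_exp (by norm_num), one_div, Real.log_inv]
    linarith
  calc (1 / 2 : ℝ) ^ 2 ^ (n - 1) * (1 - p b + p b * 2) ^ 4 ^ n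
      ≤ Real.exp (-(3 / 5)) ^ 2 ^ (n - 1) * Real.exp (1 / 4 / 2 ^ n) ^ 4 ^ n := by
        gcongr
    _ = Real.exp (-2 ^ n / 20) := by
        rw [← Real.exp_nat_mul, ← Real.exp_nat_mul, ← Real.exp_add]
        congr 1
        push_cast
        obtain ⟨m, rfl⟩ := Nat.exists_eq_succ_of_ne_zero hn
        simp only [Nat.succ_eq_add_one, Nat.add_sub_cancel]
        rw [show (4 : ℝ) ^ (m + 1) = 2 ^ (m + 1) * 2 ^ (m + 1) by rw [← mul_pow]; norm_num]
        field_simp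
        ring

/-- `F` decides up to a factor of `2`, with threshold `α`, whether both counts at `n` are at least
`2 ^ n`. -/
def Separates (F : Oracle → ℝ) (n : ℕ) (α : ℝ) (A : Oracle) : Prop :=
  ((∀ b, 2 ^ n ≤ count A b n) → α ≤ F A) ∧ ((¬ ∀ b, 2 ^ n ≤ count A b n) → F A ≤ α / 2)

theorem blockMean_add (A : Oracle) (B : Finset (List Bool)) (p : Bool → ℝ) (F G : Oracle → ℝ) :
    blockMean A B p (F + G) = blockMean A B p F + blockMean A B p G :=
  bernoulliMean_add ..

theorem blockMean_smul (A : Oracle) (B : Finset (List Bool)) (p : Bool → ℝ) (c : ℝ)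
    (F : Oracle → ℝ) : blockMean A B p (c • F) = c * blockMean A B p F :=
  bernoulliMean_smul ..

theorem blockMean_const (A : Oracle) (B : Finset (List Bool)) (p : Bool → ℝ) (c : ℝ) :
    blockMean A B p (fun _ => c) = c :=
  bernoulliMean_const ..

/-- Exponential Markov inequality: this function of the count dominates the indicator of a small
count, and its mean is computable. -/
theorem one_le_low_tail {n k : ℕ} (h : k ≤ 2 ^ n) : (1 : ℝ) ≤ 2 ^ 2 ^ n * (1 / 2) ^ k := by
  rw [one_div, inv_pow, ← div_eq_mul_inv, one_le_div (by positivity)]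
  exact pow_le_pow_right₀ one_le_two h

theorem one_le_high_tail {n k : ℕ} (hn : n ≠ 0) (h : 2 ^ n ≤ 2 * k) :
    (1 : ℝ) ≤ (1 / 2) ^ 2 ^ (n - 1) * 2 ^ k := by
  rw [one_div, inv_pow, mul_comm, ← div_eq_mul_inv, one_le_div (by positivity)]
  refine pow_le_pow_right₀ one_le_two ?_
  obtain ⟨m, rfl⟩ := Nat.exists_eq_succ_of_ne_zero hn
  rw [Nat.succ_eq_add_one, pow_succ] at h
  rw [Nat.succ_eq_add_one, Nat.add_sub_cancel]
  omega

/-! ### The degree lower bound -/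

section LowerBound

variable {A : Oracle} {n : ℕ} {F : Oracle → ℝ} {α : ℝ} {p : Bool → ℝ}

theorem le_blockMean_of_separates (hF : ∀ A, 0 ≤ F A) (hα : 0 ≤ α)
    (hs : ∀ t ⊆ blocks n, PromiseAt (overwrite A (blocks n) t) n →
      Separates F n α (overwrite A (blocks n) t))
    (hp : ∀ b, 2 / 2 ^ n ≤ p b) (hp1 : ∀ b, p b ≤ 1) :
    α * (1 - 2 * Real.exp (-2 ^ n / 20)) ≤ blockMean A (blocks n) p F := by
  set Z : Bool → Oracle → ℝ :=
    fun b => (2 ^ 2 ^ n : ℝ) • fun A => (1 / 2 : ℝ) ^ count A b n with hZ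
  have hZ0 : ∀ b A, 0 ≤ Z b A := fun b A => by simp only [hZ, Pi.smul_apply]; positivity
  -- Pointwise minorant `α * (1 - Z false - Z true)` of `F`: it is at most `α` everywhere and
  -- nonpositive once a count is below `2 ^ n`.
  have hm : blockMean A (blocks n) p
      (α • ((fun _ => 1) + ((-1 : ℝ) • Z false + (-1 : ℝ) • Z true)))
      ≤ blockMean A (blocks n) p F := by
    refine bernoulliMean_le (fun u => ⟨le_trans (by positivity) (hp _), hp1 _⟩) fun t ht => ?_
    set A' := overwrite A (blocks n) t with hA'
    simp only [Pi.smul_apply, Pi.add_apply, smul_eq_mul]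
    by_cases hc : ∀ b, 2 ^ n ≤ count A' b n
    · have h1 := (hs t ht fun b => Or.inl (hc b)).1 hc
      nlinarith [mul_nonneg hα (hZ0 false A'), mul_nonneg hα (hZ0 true A')]
    · push Not at hc
      obtain ⟨b, hb⟩ := hc
      have h1 : 1 ≤ Z b A' := one_le_low_tail hb.le
      have h2 : 1 ≤ Z false A' + Z true A' := by
        cases b <;> linarith [hZ0 false A', hZ0 true A']
      nlinarith [hF A']
  rw [blockMean_smul, blockMean_add, blockMean_add, blockMean_smul _ _ _ (-1) (Z false),
    blockMean_smul _ _ _ (-1) (Z true), blockMean_const] at hm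
  refine le_trans (mul_le_mul_of_nonneg_left ?_ hα) hm
  have h0 : blockMean A (blocks n) p (Z false) ≤ _ := blockMean_low_tail A n (hp false) (hp1 false)
  have h1 : blockMean A (blocks n) p (Z true) ≤ _ := blockMean_low_tail A n (hp true) (hp1 true)
  linarith

theorem blockMean_le_of_separates (hF : ∀ A, F A ≤ 1) (hα : 0 ≤ α) (hn : n ≠ 0)
    (hs : ∀ t ⊆ blocks n, PromiseAt (overwrite A (blocks n) t) n →
      Separates F n α (overwrite A (blocks n) t)) (b : Bool)
    (hp : 2 / 2 ^ n ≤ p b) (hp1 : p b ≤ 1) (hq : 0 ≤ p !b) (hq1 : p (!b) ≤ 1 / 4 / 2 ^ n) :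
    blockMean A (blocks n) p F ≤ α / 2 + 2 * Real.exp (-2 ^ n / 20) := by
  set Z : Oracle → ℝ := (2 ^ 2 ^ n : ℝ) • fun A => (1 / 2 : ℝ) ^ count A b n with hZ
  set Y : Oracle → ℝ := ((1 / 2 : ℝ) ^ 2 ^ (n - 1)) • fun A => (2 : ℝ) ^ count A (!b) n with hY
  have hZ0 : ∀ A, 0 ≤ Z A := fun A => by simp only [hZ, Pi.smul_apply]; positivity
  have hY0 : ∀ A, 0 ≤ Y A := fun A => by simp only [hY, Pi.smul_apply]; positivity
  -- Pointwise majorant of `F`: `Z` pays for a small count at `b`, `Y` for a count at `!b` that is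
  -- not small. These cover every violation of the promise, and `F ≤ 1` there; elsewhere separation
  -- gives `α / 2`.
  have hm : blockMean A (blocks n) p F
      ≤ blockMean A (blocks n) p ((fun _ => α / 2) + (Z + Y)) := by
    have hq2 : p (!b) ≤ 1 := by
      refine hq1.trans ?_
      have : (1 : ℝ) ≤ 2 ^ n := one_le_pow₀ one_le_two
      rw [div_le_one (by positivity)]
      linarith
    have hp0 : 0 ≤ p b := le_trans (by positivity) hp
    refine bernoulliMean_le (fun u => ?_) fun t ht => ?_
    · generalize u.headD false = c
      cases b <;> cases c <;> exact ⟨by assumption, by assumption⟩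
    · set A' := overwrite A (blocks n) t with hA'
      simp only [Pi.add_apply]
      rcases le_or_gt (2 ^ n) (count A' b n) with h1 | h1
      · rcases le_or_gt (2 ^ n) (2 * count A' (!b) n) with h2 | h2
        · have h3 : 1 ≤ Y A' := one_le_high_tail hn h2
          linarith [hF A', hZ0 A']
        · have hpr : PromiseAt A' n := fun c => by
            by_cases hc : c = b
            · exact Or.inl (hc ▸ h1)
            · rw [← ne_eq, ← Bool.eq_not] at hc
              exact Or.inr (hc ▸ h2.le)
          have h3 := (hs t ht hpr).2 fun h => by
            have h4 : 2 ^ n ≤ count A' (!b) n := h !b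
            omega
          linarith [hZ0 A', hY0 A']
      · have h3 : 1 ≤ Z A' := one_le_low_tail h1.le
        linarith [hF A', hY0 A']
  rw [blockMean_add, blockMean_add, blockMean_const] at hm
  have h0 := blockMean_low_tail A n hp hp1
  have h1 := blockMean_high_tail A hn hq hq1
  linarith

/-- No polynomial of degree `d` with `100 * d ^ 2 ≤ 2 ^ n` decides up to a factor of `2` whether
both counts at `n` are at least `2 ^ n`, not even under the promise. -/
theorem exists_not_separates {d : ℕ} (hd : F ∈ degreeLE ℝ d) (hF0 : ∀ A, 0 ≤ F A)
    (hF1 : ∀ A, F A ≤ 1) (hα0 : 0 < α) (hα1 : α ≤ 1) (hn : 6 ≤ n)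
    (hα : 100 * Real.exp (-2 ^ n / 20) ≤ α) (hdn : 100 * d ^ 2 ≤ 2 ^ n) (A : Oracle) :
    ∃ t ⊆ blocks n, PromiseAt (overwrite A (blocks n) t) n ∧
      ¬ Separates F n α (overwrite A (blocks n) t) := by
  by_contra! hs
  set δ := Real.exp (-2 ^ n / 20) with hδ
  have hδ0 : 0 < δ := Real.exp_pos _
  set θ : ℝ := 2 / 2 ^ n with hθ
  have hn0 : n ≠ 0 := by omega
  have h64 : (64 : ℝ) ≤ 2 ^ n := by
    calc (64 : ℝ) = 2 ^ 6 := by norm_num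
      _ ≤ 2 ^ n := pow_le_pow_right₀ one_le_two hn
  have hθ0 : 0 < θ := by positivity
  have hθ1 : θ ≤ 1 := by rw [hθ, div_le_one (by positivity)]; linarith
  obtain ⟨Q, hQd, hQ⟩ := exists_polynomial_blockMean hd A (blocks n) θ
  have hQ2 : 2 * (α * (1 - 2 * δ)) ≤ Q.eval 2 := by
    have h1 := hQ 1 one_ne_zero
    rw [inv_one, mul_one, one_add_one_eq_two] at h1
    have h2 := le_blockMean_of_separates (p := pairProb θ θ) hF0 hα0.le hs
      (fun b => by cases b <;> simp [pairProb, hθ]) (fun b => by cases b <;> simp [pairProb, hθ1])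
    rw [h1]
    linarith
  have hnonneg : ∀ p : Bool → ℝ, (∀ b, 0 ≤ p b ∧ p b ≤ 1) → 0 ≤ blockMean A (blocks n) p F := by
    intro p hp
    rw [← blockMean_const A (blocks n) p 0]
    exact bernoulliMean_le (fun u => hp _) fun t _ => hF0 _
  -- The value `65 / 8` is `8 + 1 / 8`, so that `t ≥ 8` makes the smaller mean count at most `2 ^ n
  -- / 4`. The upper end keeps `θ * t` a probability.
  have hQs : ∀ s, 65 / 8 ≤ s → s ≤ 2 ^ n / 2 → 0 ≤ Q.eval s ∧ Q.eval s ≤ α + 4 * δ := by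
    intro s h1 h2
    -- The larger root of `t ^ 2 - s * t + 1 = 0` is `(s + r) / 2`.
    set r := Real.sqrt (s ^ 2 - 4) with hr
    have hr2 : r ^ 2 = s ^ 2 - 4 := Real.sq_sqrt (by nlinarith)
    have hr0 : 63 / 8 ≤ r := Real.le_sqrt_of_sq_le (by nlinarith)
    have hrs : r ≤ s := Real.sqrt_le_iff.2 ⟨by linarith, by linarith⟩
    set t := (s + r) / 2 with ht
    have ht8 : 8 ≤ t := by linarith
    have htinv : t⁻¹ = (s - r) / 2 := by
      refine inv_eq_of_mul_eq_one_right ?_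
      rw [ht]
      linear_combination -hr2 / 4
    have hst : t + t⁻¹ = s := by rw [htinv, ht]; ring
    have hti8 : t⁻¹ ≤ 1 / 8 := by
      rw [one_div]
      exact inv_anti₀ (by norm_num) ht8
    have hti0 : 0 < t⁻¹ := by positivity
    have hθt : θ * t ≤ 1 := by
      rw [hθ, div_mul_eq_mul_div, div_le_one (by positivity)]
      linarith
    have hθt' : 2 / 2 ^ n ≤ θ * t := by nlinarith
    have hθi : θ * t⁻¹ ≤ 1 / 4 / 2 ^ n := by
      rw [hθ, div_mul_eq_mul_div, div_le_div_iff_of_pos_right (by positivity)]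
      linarith
    have hθi0 : 0 ≤ θ * t⁻¹ := by positivity
    have hθi1 : θ * t⁻¹ ≤ 1 := by nlinarith
    have hθt0 : 0 ≤ θ * t := by positivity
    rw [← hst, hQ t (by positivity)]
    constructor
    · refine add_nonneg (hnonneg _ fun b => ?_) (hnonneg _ fun b => ?_) <;> cases b <;>
        simp only [pairProb, if_true, Bool.false_eq_true, if_false] <;> constructor <;> assumption
    · have h3 := blockMean_le_of_separates (p := pairProb (θ * t) (θ * t⁻¹)) hF1 hα0.le hn0 hs
        false hθt' hθt hθi0 hθi
      have h4 := blockMean_le_of_separates (p := pairProb (θ * t⁻¹) (θ * t)) hF1 hα0.le hn0 hs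
        true hθt' hθt hθi0 hθi
      linarith
  -- Since `100 * δ ≤ α`, the values of `Q` on the interval lie between `0` and `(104 / 100) * α`;
  -- the factor `c` makes `c * Q - 1` lie in `[-1, 1]`. At `s = 2` it still exceeds `2 > cosh 1`.
  set c : ℝ := (52 / 100 * α)⁻¹ with hc
  have hcα : c * (52 / 100 * α) = 1 := inv_mul_cancel₀ (by positivity)
  have hc0 : 0 < c := by positivity
  have hev : ∀ s, (C c * Q - 1).eval s = c * Q.eval s - 1 := fun s => by simp
  have hcδ : c * (100 * δ) ≤ c * α := mul_le_mul_of_nonneg_left hα hc0.le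
  have hdR : (100 : ℝ) * d ^ 2 ≤ 2 ^ n := by exact_mod_cast hdn
  have key := eval_le_cosh_one (P := C c * Q - 1) (d := d) (a := 65 / 8) (b := 2 ^ n / 2)
    (c := 49 / 8) ?_ (by linarith) (by norm_num) ?_ (by linarith)
  · have h1 := cosh_one_lt
    rw [hev, show (65 / 8 - 49 / 8 : ℝ) = 2 by norm_num] at key
    have h2 := mul_le_mul_of_nonneg_left hQ2 hc0.le
    have h3 : α * δ ≤ δ := by nlinarith
    have h4 := mul_le_mul_of_nonneg_left h3 hc0.le
    nlinarith
  · refine (natDegree_sub_le _ _).trans (max_le ((natDegree_C_mul_le _ _).trans hQd) ?_)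
    simp
  · intro s h1 h2
    obtain ⟨h3, h4⟩ := hQs s h1 h2
    rw [hev, abs_le]
    have h5 := mul_nonneg hc0.le h3
    have h6 := mul_le_mul_of_nonneg_left h4 hc0.le
    constructor <;> nlinarith

end LowerBound

open Filter Topology

/-! ## Diagonalization -/

theorem eventually_eval_le_two_pow (P : Polynomial ℕ) : ∀ᶠ n in atTop, P.eval n ≤ 2 ^ n := by
  have h : (fun n : ℕ => ((P.eval n : ℕ) : ℝ)) =o[atTop] fun n : ℕ => (2 : ℝ) ^ n := by
    induction P using Polynomial.induction_on' with
    | add p q hp hq => simpa using hp.add hq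
    | monomial k a =>
      simp only [Polynomial.eval_monomial, Nat.cast_mul, Nat.cast_pow]
      exact (isLittleO_pow_const_const_pow_of_one_lt k one_lt_two).const_mul_left _
  filter_upwards [h.bound one_pos] with n hn
  rw [one_mul, Real.norm_of_nonneg (by positivity), Real.norm_of_nonneg (by positivity)] at hn
  exact_mod_cast hn

theorem continuous_count (b : Bool) (n : ℕ) : Continuous fun A : Oracle => count A b n := by
  simp only [count, Finset.card_filter]
  refine continuous_finsetSum _ fun u _ => ?_
  exact (continuous_of_discreteTopology (f := fun b : Bool => if b = true then 1 else 0)).comp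
    (continuous_apply u)

/-- A family of polynomials in the bits of the oracle, with thresholds, as given by the acceptance
probability of an efficient algorithm. -/
def IsTest (F : ℕ → Oracle → ℝ) (α : ℕ → ℝ) : Prop :=
  (∀ n A, 0 ≤ F n A ∧ F n A ≤ 1) ∧ (∀ n, α n ≤ 1) ∧
    ∃ d σ : Polynomial ℕ, ∀ n, F n ∈ degreeLE ℝ (d.eval n) ∧ (2 ^ σ.eval n : ℝ)⁻¹ ≤ α n

theorem IsTest.eventually_exists_not_separates {F : ℕ → Oracle → ℝ} {α : ℕ → ℝ}
    (h : IsTest F α) (A : Oracle) :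
    ∀ᶠ n in atTop, ∃ t ⊆ blocks n, PromiseAt (overwrite A (blocks n) t) n ∧
      ¬ Separates (F n) n (α n) (overwrite A (blocks n) t) := by
  obtain ⟨hF, hα, d, σ, hd⟩ := h
  -- The second condition makes the tail at most `exp (-(σ + 7))`; the `7` absorbs the factor `100 <
  -- 2 ^ 7`.
  filter_upwards [eventually_eval_le_two_pow (100 * d ^ 2),
    eventually_eval_le_two_pow (20 * (σ + 7)), eventually_ge_atTop 6] with n h1 h2 h3
  simp only [Polynomial.eval_mul, Polynomial.eval_pow, Polynomial.eval_add,
    Polynomial.eval_ofNat] at h1 h2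
  refine exists_not_separates (hd n).1 (fun A => (hF n A).1) (fun A => (hF n A).2)
    (lt_of_lt_of_le (by positivity) (hd n).2) (hα n) h3 (le_trans ?_ (hd n).2) h1 A
  have h2' : (20 : ℝ) * ((σ.eval n : ℕ) + 7) ≤ 2 ^ n := by exact_mod_cast h2
  have h4 : Real.exp (-1) ≤ 1 / 2 := by
    have := Real.exp_one_gt_d9
    rw [Real.exp_neg, one_div]
    exact inv_anti₀ (by norm_num) (by linarith)
  calc 100 * Real.exp (-2 ^ n / 20) ≤ 100 * Real.exp ((σ.eval n + 7 : ℕ) * (-1 : ℝ)) := by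
        gcongr
        push_cast
        linarith
    _ ≤ 100 * (1 / 2) ^ (σ.eval n + 7) := by
        rw [Real.exp_nat_mul]
        gcongr
    _ ≤ (2 ^ σ.eval n : ℝ)⁻¹ := by
        rw [pow_add, one_div, inv_pow]
        have : (0 : ℝ) < (2 ^ σ.eval n : ℝ)⁻¹ := by positivity
        norm_num
        linarith

/-- Largeness of both counts is clopen, as it depends on finitely many bits, and failing a
non-strict inequality for the continuous `F` is open. -/
theorem isOpen_not_separates {F : Oracle → ℝ} (hF : Continuous F) (n : ℕ) (α : ℝ) :
    IsOpen {A | ¬ Separates F n α A} := by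
  have hc : IsClopen {A : Oracle | ∀ b, 2 ^ n ≤ count A b n} := by
    rw [Set.ofPred_forall]
    exact isClopen_iInter_of_finite fun b =>
      (isClopen_discrete (Set.Ici (2 ^ n))).preimage (continuous_count b n)
  have h : {A | ¬ Separates F n α A} =
      ({A : Oracle | ∀ b, 2 ^ n ≤ count A b n} ∩ {A | F A < α}) ∪
        ({A : Oracle | ∀ b, 2 ^ n ≤ count A b n}ᶜ ∩ {A | α / 2 < F A}) := by
    ext A
    simp only [Separates, Set.mem_ofPred_eq, Set.mem_union, Set.mem_inter_iff, Set.mem_compl_iff,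
      not_and_or, Classical.not_imp, not_le]
  rw [h]
  exact (hc.isOpen.inter (isOpen_lt hF continuous_const)).union
    (hc.compl.isOpen.inter (isOpen_lt continuous_const hF))

theorem isClosed_promise : IsClosed {A : Oracle | ∀ n, PromiseAt A n} := by
  simp only [PromiseAt, Set.ofPred_forall]
  refine isClosed_iInter fun n => isClosed_iInter fun b => ?_
  exact (isClosed_discrete {k | 2 ^ n ≤ k ∨ 2 * k ≤ 2 ^ n}).preimage (continuous_count b n)

/-- Countably many tests fail simultaneously on some oracle that satisfies the promise. -/
theorem exists_oracle_forall_not_separates {ι : Type*} [Countable ι] {F : ι → ℕ → Oracle → ℝ}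
    {α : ι → ℕ → ℝ} (h : ∀ i, IsTest (F i) (α i)) :
    ∃ A : Oracle, (∀ n, PromiseAt A n) ∧ ∀ i, ∃ n, ¬ Separates (F i n) n (α i n) A := by
  let X := {A : Oracle // ∀ n, PromiseAt A n}
  have : CompactSpace X := isCompact_iff_compactSpace.1 isClosed_promise.isCompact
  have : Nonempty X := ⟨⟨fun _ => false, fun n b => Or.inr (by simp [count])⟩⟩
  -- Baire category in the compact Hausdorff space `X`.
  have hd : Dense (⋂ i, {A : X | ∃ n, ¬ Separates (F i n) n (α i n) A.1}) := by
    refine dense_iInter_of_isOpen (fun i => ?_) fun i => ?_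
    · rw [Set.ofPred_exists]
      refine isOpen_iUnion fun n => ?_
      obtain ⟨d, σ, hdσ⟩ := (h i).2.2
      exact (isOpen_not_separates (continuous_of_mem_degreeLE (hdσ n).1) n _).preimage
        continuous_subtype_val
    · rintro ⟨A, hA⟩
      have hev := (h i).eventually_exists_not_separates A
      obtain ⟨N, hN⟩ := eventually_atTop.1 hev
      choose! t ht using hN
      have hpr : ∀ n, N ≤ n → ∀ m, PromiseAt (overwrite A (blocks n) (t n)) m := by
        intro n hn m
        rcases eq_or_ne n m with rfl | hnm
        · exact (ht n hn).2.1
        · intro b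
          rw [count_overwrite_of_ne b hnm]
          exact hA m b
      refine mem_closure_of_tendsto (b := atTop) (f := fun n => if hn : N ≤ n then
        (⟨overwrite A (blocks n) (t n), hpr n hn⟩ : X) else ⟨A, hA⟩) ?_ ?_
      · rw [tendsto_subtype_rng, tendsto_pi_nhds]
        intro u
        refine tendsto_nhds_of_eventually_eq ?_
        filter_upwards [eventually_ge_atTop u.length, eventually_ge_atTop 1] with n hn hn1
        have hu : u ∉ blocks n := fun h2 => by
          rcases Finset.mem_union.1 h2 with h3 | h3 <;> have h3 := (mem_block.1 h3).2 <;> omega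
        split_ifs with h2
        · simp [overwrite, hu]
        · rfl
      · filter_upwards [eventually_ge_atTop N] with n hn
        rw [dif_pos hn]
        exact ⟨n, (ht n hn).2.2⟩
  obtain ⟨A, hA⟩ := hd.nonempty
  exact ⟨A.1, A.2, fun i => Set.mem_iInter.1 hA i⟩

/-! ## Countability -/

instance (k s : ℕ) : Finite (Instr k s) := by
  let f : Instr k s → (Fin (k + 2) × Bool × Fin (s + 1)) ⊕
      (Fin (k + 2) × (Option Bool → Fin (s + 1))) ⊕ (Bool → Fin (s + 1)) ⊕
      (Bool → Fin (s + 1)) ⊕ Bool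
    | .push i b q => .inl (i, b, q)
    | .pop i q => .inr (.inl (i, q))
    | .toss q => .inr (.inr (.inl q))
    | .query q => .inr (.inr (.inr (.inl q)))
    | .halt b => .inr (.inr (.inr (.inr b)))
  refine Finite.of_injective f fun a b h => ?_
  cases a <;> cases b <;> simp_all [f]

instance : Countable Machine := by
  let f : Machine → (Σ k : ℕ, Σ s : ℕ, Fin (s + 1) → Instr k s) := fun M => ⟨M.work, M.states, M.prog⟩
  refine Function.Injective.countable (f := f) ?_
  rintro ⟨k, s, p⟩ ⟨k', s', p'⟩ h
  simp only [f, Sigma.mk.injEq] at h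
  obtain ⟨rfl, h⟩ := h
  simp only [heq_eq_eq, Sigma.mk.injEq] at h
  obtain ⟨rfl, h⟩ := h
  rw [eq_of_heq h]

instance : Countable (Polynomial ℕ) :=
  Cardinal.mk_le_aleph0_iff.1 (Polynomial.cardinalMk_le_max.trans (by simp))

/-- A uniform family is determined by a generating machine and its time bound, because circuit codes
are injective. -/
instance : Countable {C : ℕ → QCircuit // PolyTimeUniform C} := by
  choose M p h using fun C : {C : ℕ → QCircuit // PolyTimeUniform C} => C.2
  refine Function.Injective.countable (f := fun C => (M C, p C)) fun C D hCD => ?_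
  simp only [Prod.mk.injEq] at hCD
  refine Subtype.ext (funext fun n => QCircuit.code_injective ?_)
  rw [← ((h C).2 n).2, ← ((h D).2 n).2, hCD.1, hCD.2]

/-! ## Probabilistic machines -/

/-- With the coins fixed the run is a decision tree, and each step branches on at most one oracle
bit. -/
theorem Machine.foldl_step_mem_degreeLE (M : Machine) (g : M.Cfg → ℝ) (l : List Bool)
    (c : M.Cfg) : (fun A => g (l.foldl (fun c b => M.step A b c) c)) ∈ degreeLE ℝ l.length := by
  induction l generalizing c with
  | nil => exact const_mem_degreeLE 0 (g c)
  | cons b l ih =>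
    simp only [List.foldl_cons, List.length_cons]
    cases hc : M.prog c.state with
    | query q =>
      convert ite_mem_degreeLE (c.stk 1) (ih ⟨q true, c.stk⟩) (ih ⟨q false, c.stk⟩) using 1
      ext A
      simp only [Machine.step, hc]
      cases A (c.stk 1) <;> simp
    | _ =>
      simp only [Machine.step, hc]
      exact degreeLE_mono (Nat.le_succ _) (ih _)

theorem Machine.acceptProb_eq_sum (M : Machine) (A : Oracle) (x : List Bool) (T : ℕ) :
    M.acceptProb A x T =
      (∑ r : Fin T → Bool, if M.verdict (M.run A x r) = some true then (1 : ℝ) else 0) / 2 ^ T := by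
  rw [Machine.acceptProb, Finset.card_filter]
  push_cast
  rfl

theorem Machine.acceptProb_mem_degreeLE (M : Machine) (x : List Bool) (T : ℕ) :
    (fun A => M.acceptProb A x T) ∈ degreeLE ℝ T := by
  have h : (fun A => M.acceptProb A x T) = (2 ^ T : ℝ)⁻¹ • ∑ r : Fin T → Bool,
      fun A => if M.verdict (M.run A x r) = some true then (1 : ℝ) else 0 := by
    ext A
    rw [M.acceptProb_eq_sum, Pi.smul_apply, Finset.sum_apply, smul_eq_mul, mul_comm, div_eq_mul_inv]
  rw [h]
  refine Submodule.smul_mem _ _ (sum_mem fun r _ => ?_)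
  have h1 := M.foldl_step_mem_degreeLE (fun c => if M.verdict c = some true then 1 else 0)
    (List.ofFn r) (M.start x)
  rwa [List.length_ofFn] at h1

theorem Machine.acceptProb_nonneg (M : Machine) (A : Oracle) (x : List Bool) (T : ℕ) :
    0 ≤ M.acceptProb A x T := by
  rw [Machine.acceptProb]
  positivity

theorem Machine.acceptProb_le_one (M : Machine) (A : Oracle) (x : List Bool) (T : ℕ) :
    M.acceptProb A x T ≤ 1 := by
  rw [Machine.acceptProb, div_le_one (by positivity)]
  refine (Nat.cast_le.2 (Finset.card_filter_le _ _)).trans ?_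
  simp

/-- The probability of having accepted after `T` further steps. -/
noncomputable def Machine.acceptFrom (M : Machine) (A : Oracle) : ℕ → M.Cfg → ℝ
  | 0, c => if M.verdict c = some true then 1 else 0
  | T + 1, c => (M.acceptFrom A T (M.step A true c) + M.acceptFrom A T (M.step A false c)) / 2

theorem sum_fin_succ_bool {β : Type*} [AddCommMonoid β] (T : ℕ) (f : (Fin (T + 1) → Bool) → β) :
    ∑ r, f r = (∑ r : Fin T → Bool, f (Fin.cons true r)) + ∑ r : Fin T → Bool, f (Fin.cons false r) := by
  rw [← (Fin.consEquiv fun _ => Bool).sum_comp f, Fintype.sum_prod_type, Fintype.sum_bool]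
  rfl

theorem Machine.acceptFrom_eq_sum (M : Machine) (A : Oracle) (T : ℕ) (c : M.Cfg) :
    M.acceptFrom A T c = (∑ r : Fin T → Bool,
      if M.verdict ((List.ofFn r).foldl (fun c b => M.step A b c) c) = some true
        then (1 : ℝ) else 0) / 2 ^ T := by
  induction T generalizing c with
  | zero => simp [Machine.acceptFrom]
  | succ T ih =>
    rw [Machine.acceptFrom, ih, ih, sum_fin_succ_bool]
    simp only [List.ofFn_succ, Fin.cons_zero, Fin.cons_succ, List.foldl_cons]
    rw [pow_succ]
    ring

theorem Machine.acceptProb_eq_acceptFrom (M : Machine) (A : Oracle) (x : List Bool) (T : ℕ) :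
    M.acceptProb A x T = M.acceptFrom A T (M.start x) := by
  rw [M.acceptProb_eq_sum, M.acceptFrom_eq_sum]
  rfl

/-! ## Sampling in a block -/

/-- The machine which replaces every bit of the input by two random bits, prefixes the result by
`b`, and accepts if the resulting string is in the oracle. -/
def sampler (b : Bool) : Machine where
  work := 0
  states := 10
  prog := ![.pop 0 fun o => if o.isSome = true then 1 else 7,
    .toss fun c => if c = true then 3 else 2, .push 1 false 4, .push 1 true 4,
    .toss fun c => if c = true then 6 else 5, .push 1 false 0, .push 1 true 0,
    .push 1 b 8, .query fun a => if a = true then 10 else 9, .halt false, .halt true]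

/-- The configuration of the sampler with control state `s`, rest of the input `x` and query `q`. -/
def samplerCfg (b : Bool) (s : Fin 11) (x q : List Bool) : (sampler b).Cfg :=
  ⟨s, ![x, q]⟩

theorem sampler_start (b : Bool) (x : List Bool) :
    (sampler b).start x = samplerCfg b 0 x [] := by
  refine congrArg (Machine.Cfg.mk _) (funext fun i => ?_)
  change Fin 2 at i
  fin_cases i <;> rfl

theorem update_pair_zero (x y q : List Bool) :
    Function.update (![x, q] : Fin 2 → List Bool) 0 y = ![y, q] := by
  ext i : 1
  fin_cases i <;> rfl

theorem update_pair_one (x y q : List Bool) :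
    Function.update (![x, q] : Fin 2 → List Bool) 1 y = ![x, y] := by
  ext i : 1
  fin_cases i <;> rfl

section Sampler

variable (A : Oracle) (b : Bool)

/-- One round takes five steps: pop, toss, push, toss, push. Only `c₂` and `c₄` matter; the coins of
the other steps are ignored. -/
theorem sampler_loop (a : Bool) (x q : List Bool) (c₁ c₂ c₃ c₄ c₅ : Bool) :
    (sampler b).step A c₅ ((sampler b).step A c₄ ((sampler b).step A c₃ ((sampler b).step A c₂
      ((sampler b).step A c₁ (samplerCfg b 0 (a :: x) q))))) = samplerCfg b 0 x (c₄ :: c₂ :: q) := by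
  have h1 : (sampler b).step A c₁ (samplerCfg b 0 (a :: x) q) = samplerCfg b 1 x q :=
    congrArg (Machine.Cfg.mk _) (update_pair_zero _ _ _)
  have h2 : (sampler b).step A c₂ (samplerCfg b 1 x q) =
      samplerCfg b (if c₂ = true then 3 else 2) x q := rfl
  have h3 : (sampler b).step A c₃ (samplerCfg b (if c₂ = true then 3 else 2) x q) =
      samplerCfg b 4 x (c₂ :: q) := by
    cases c₂ <;> exact congrArg (Machine.Cfg.mk _) (update_pair_one _ _ _)
  have h4 : (sampler b).step A c₄ (samplerCfg b 4 x (c₂ :: q)) =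
      samplerCfg b (if c₄ = true then 6 else 5) x (c₂ :: q) := rfl
  have h5 : (sampler b).step A c₅ (samplerCfg b (if c₄ = true then 6 else 5) x (c₂ :: q)) =
      samplerCfg b 0 x (c₄ :: c₂ :: q) := by
    cases c₄ <;> exact congrArg (Machine.Cfg.mk _) (update_pair_one _ _ _)
  rw [h1, h2, h3, h4, h5]

theorem sampler_end (q : List Bool) (c₁ c₂ c₃ : Bool) :
    (sampler b).step A c₃ ((sampler b).step A c₂ ((sampler b).step A c₁ (samplerCfg b 0 [] q))) =
      samplerCfg b (if A (b :: q) = true then 10 else 9) [] (b :: q) := by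
  have h1 : (sampler b).step A c₁ (samplerCfg b 0 [] q) = samplerCfg b 7 [] q :=
    congrArg (Machine.Cfg.mk _) (update_pair_zero _ _ _)
  have h2 : (sampler b).step A c₂ (samplerCfg b 7 [] q) = samplerCfg b 8 [] (b :: q) :=
    congrArg (Machine.Cfg.mk _) (update_pair_one _ _ _)
  rw [h1, h2]
  rfl

theorem sampler_halts (x q l : List Bool) (hl : l.length = 5 * x.length + 3) :
    ((sampler b).verdict
      (l.foldl (fun c r => (sampler b).step A r c) (samplerCfg b 0 x q))).isSome = true := by
  induction x generalizing q l with
  | nil =>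
    match l, hl with
    | [c₁, c₂, c₃], _ =>
      simp only [List.foldl_cons, List.foldl_nil, sampler_end]
      split <;> rfl
  | cons a x ih =>
    match l, hl with
    | c₁ :: c₂ :: c₃ :: c₄ :: c₅ :: l, hl =>
      simp only [List.foldl_cons, sampler_loop]
      refine ih _ _ ?_
      simp only [List.length_cons] at hl
      omega

/-- The sampler pushes onto a stack, so its first random bit ends up deepest; hence the last
coordinate is the one split off. -/
theorem sum_ofFn_append (m : ℕ) (q : List Bool) (g : List Bool → ℝ) :
    ∑ y : Fin (m + 1) → Bool, g (List.ofFn y ++ q) =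
      (∑ y : Fin m → Bool, g (List.ofFn y ++ true :: q))
        + ∑ y : Fin m → Bool, g (List.ofFn y ++ false :: q) := by
  rw [← (Fin.snocEquiv fun _ => Bool).sum_comp, Fintype.sum_prod_type, Fintype.sum_bool]
  have h : ∀ (c : Bool) (y : Fin m → Bool),
      List.ofFn (Fin.snoc (α := fun _ => Bool) y c) ++ q = List.ofFn y ++ c :: q := by
    intro c y
    rw [List.ofFn_succ']
    simp [Fin.snoc_castSucc, Fin.snoc_last]
  simp only [Fin.snocEquiv, Equiv.coe_fn_mk, h]

theorem sampler_acceptFrom (x q : List Bool) :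
    (sampler b).acceptFrom A (5 * x.length + 3) (samplerCfg b 0 x q) =
      (∑ y : Fin (2 * x.length) → Bool,
        if A (b :: (List.ofFn y ++ q)) = true then (1 : ℝ) else 0) / 4 ^ x.length := by
  induction x generalizing q with
  | nil =>
    simp only [List.length_nil, Machine.acceptFrom, sampler_end]
    have h1 : (sampler b).verdict (samplerCfg b 10 [] (b :: q)) = some true := rfl
    have h0 : (sampler b).verdict (samplerCfg b 9 [] (b :: q)) = some false := rfl
    by_cases hA : A (b :: q) = true <;> simp [hA, h0, h1]
  | cons a x ih =>
    have h5 : 5 * (a :: x).length + 3 = (5 * x.length + 3) + 1 + 1 + 1 + 1 + 1 := by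
      simp only [List.length_cons]; omega
    rw [h5]
    generalize 5 * x.length + 3 = T at ih ⊢
    simp only [Machine.acceptFrom, sampler_loop, ih]
    rw [List.length_cons, show 2 * (x.length + 1) = 2 * x.length + 1 + 1 by ring,
      sum_ofFn_append _ q fun u => if A (b :: u) = true then (1 : ℝ) else 0,
      sum_ofFn_append _ _ fun u => if A (b :: u) = true then (1 : ℝ) else 0,
      sum_ofFn_append _ _ fun u => if A (b :: u) = true then (1 : ℝ) else 0, pow_succ]
    ring

theorem sampler_acceptProb (x : List Bool) :
    (sampler b).acceptProb A x (5 * x.length + 3) = count A b x.length / 4 ^ x.length := by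
  rw [Machine.acceptProb_eq_acceptFrom, sampler_start, sampler_acceptFrom]
  congr 1
  rw [count, Finset.card_filter, block, Finset.sum_image]
  · simp
  · exact fun y _ z _ h => List.ofFn_injective (List.cons_injective h)

end Sampler

/-- The language of the inputs `x` for which the count at `|x|` is large. -/
def countLanguage (A : Oracle) (b : Bool) : Language Bool :=
  {x | 2 ^ x.length ≤ count A b x.length}

/-- The sampler accepts with probability `count / 4 ^ n`, which the promise puts at `2 ^ (-n)` or
more, or at half of that or less. -/
theorem countLanguage_mem_SBP {A : Oracle} (hA : ∀ n, PromiseAt A n) (b : Bool) :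
    countLanguage A b ∈ SBP A := by
  have hp : ∀ n, (5 * Polynomial.X + 3 : Polynomial ℕ).eval n = 5 * n + 3 := fun n => by simp
  have hc : ∀ x, x ∈ countLanguage A b ↔ 2 ^ x.length ≤ count A b x.length := fun x => Iff.rfl
  have h4 : ∀ n : ℕ, (4 : ℝ) ^ n = 2 ^ n * 2 ^ n := fun n => by rw [← mul_pow]; norm_num
  refine ⟨sampler b, 5 * Polynomial.X + 3, Polynomial.X, fun x r => ?_, fun x => ⟨?_, ?_⟩⟩
  · rw [Machine.run, sampler_start]
    exact sampler_halts A b x [] _ (by simp)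
  · intro hx
    have h : (2 : ℝ) ^ x.length ≤ count A b x.length := by exact_mod_cast (hc x).1 hx
    rw [hp, sampler_acceptProb, Polynomial.eval_X, h4, ← div_div, inv_eq_one_div]
    gcongr
    rwa [one_le_div (by positivity)]
  · intro hx
    have h1 := (hA x.length b).resolve_left fun h => hx ((hc x).2 h)
    have h : 2 * (count A b x.length : ℝ) ≤ 2 ^ x.length := by exact_mod_cast h1
    rw [hp, sampler_acceptProb, Polynomial.eval_X, h4, ← div_div, inv_eq_one_div, div_right_comm 1]
    rw [div_le_div_iff_of_pos_right (by positivity),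
      div_le_div_iff₀ (by positivity) (by positivity)]
    linarith

theorem Machine.isTest (M : Machine) (p σ : Polynomial ℕ) :
    IsTest (fun n A => M.acceptProb A (List.replicate n true) (p.eval n))
      fun n => (2 ^ σ.eval n : ℝ)⁻¹ :=
  ⟨fun _ _ => ⟨M.acceptProb_nonneg _ _ _, M.acceptProb_le_one _ _ _⟩,
    fun _ => inv_le_one_of_one_le₀ (one_le_pow₀ one_le_two),
    p, σ, fun _ => ⟨M.acceptProb_mem_degreeLE _ _, le_rfl⟩⟩

open Matrix

/-! ## Quantum circuits -/

section Circuits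

variable {n : ℕ}

/-- Only an oracle gate raises the degree: on a fixed basis state it chooses between two amplitudes
according to one oracle bit. Other gates are linear with coefficients independent of the oracle. -/
theorem Gate.apply_mem_degreeLE (g : Gate n) {v : Oracle → QState n} {d : ℕ}
    (hv : ∀ y, (fun A => v A y) ∈ degreeLE ℂ d) (y : Fin n → Bool) :
    (fun A => g.apply A (v A) y) ∈ degreeLE ℂ (d + 1) := by
  have hmono := degreeLE_mono (𝕜 := ℂ) (Nat.le_succ d)
  cases g with
  | hadamard i =>
    refine hmono ?_
    have h := Submodule.smul_mem _ (Real.sqrt 2 : ℂ)⁻¹ (add_mem (hv (Function.update y i false))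
      (Submodule.smul_mem _ (if y i = true then -1 else 1) (hv (Function.update y i true))))
    convert h using 1
    ext A
    simp only [Gate.apply, Pi.smul_apply, Pi.add_apply, smul_eq_mul, div_eq_mul_inv]
    ring
  | phase i => exact hmono (Submodule.smul_mem _ _ (hv y))
  | cnot c t h => exact hmono (hv _)
  | oracle q t h =>
    convert ite_mem_degreeLE (q.map y) (hv (Function.update y t !(y t))) (hv y) using 1
    ext A
    simp only [Gate.apply]
    cases A (q.map y) <;> simp

theorem foldl_apply_mem_degreeLE (gs : List (Gate n)) {v : Oracle → QState n} {d : ℕ}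
    (hv : ∀ y, (fun A => v A y) ∈ degreeLE ℂ d) (y : Fin n → Bool) :
    (fun A => gs.foldl (fun u g => g.apply A u) (v A) y) ∈ degreeLE ℂ (d + gs.length) := by
  induction gs generalizing v d with
  | nil => exact hv y
  | cons g gs ih =>
    have h := ih (v := fun A => g.apply A (v A)) (d := d + 1) (g.apply_mem_degreeLE hv)
    rwa [add_assoc, add_comm 1] at h

theorem QCircuit.eval_mem_degreeLE (C : QCircuit) (v : QState (C.extra + 1))
    (y : Fin (C.extra + 1) → Bool) : (fun A => C.eval A v y) ∈ degreeLE ℂ C.gates.length := by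
  have h := foldl_apply_mem_degreeLE C.gates (v := fun _ => v) (d := 0)
    (fun y => const_mem_degreeLE 0 (v y)) y
  rwa [zero_add] at h

theorem ite_norm_sq_eq (b : Bool) (z : ℂ) : (if b = true then ‖z‖ ^ 2 else 0) =
    ((if b = true then (1 : ℂ) else 0) * (star z * z)).re := by
  cases b
  · simp
  · rw [if_pos rfl, if_pos rfl, one_mul, Complex.star_def, ← Complex.normSq_eq_conj_mul_self,
      Complex.ofReal_re, Complex.normSq_eq_norm_sq]

theorem QCircuit.acceptProb_mem_degreeLE (C : QCircuit) (v : QState (C.extra + 1)) :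
    (fun A => C.acceptProb A v) ∈ degreeLE ℝ (2 * C.gates.length) := by
  have h : (fun A => C.acceptProb A v) = ∑ y : Fin (C.extra + 1) → Bool,
      fun A => ((if y 0 = true then (1 : ℂ) else 0) * (star (C.eval A v y) * C.eval A v y)).re := by
    ext A
    rw [QCircuit.acceptProb, Finset.sum_apply]
    exact Finset.sum_congr rfl fun y _ => ite_norm_sq_eq _ _
  rw [h, two_mul]
  refine sum_mem fun y _ => re_mem_degreeLE ?_
  exact Submodule.smul_mem _ _ (mul_mem_degreeLE (conj_mem_degreeLE (C.eval_mem_degreeLE v y))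
    (C.eval_mem_degreeLE v y))

/-! ### Gates preserve the norm and are linear -/

theorem sum_comp_update_xor {β : Type*} [AddCommMonoid β] (t : Fin n) (f : (Fin n → Bool) → Bool)
    (hf : ∀ y c, f (Function.update y t c) = f y) (φ : (Fin n → Bool) → β) :
    ∑ y, φ (Function.update y t (xor (y t) (f y))) = ∑ y, φ y := by
  have hinv : Function.Involutive fun y : Fin n → Bool =>
      Function.update y t (xor (y t) (f y)) := fun y => by
    simp [hf]
  exact Equiv.sum_comp hinv.toPerm φ

theorem hadamard_parallelogram (a b : ℂ) :
    ‖(a + b) / (Real.sqrt 2 : ℂ)‖ ^ 2 + ‖(a - b) / (Real.sqrt 2 : ℂ)‖ ^ 2 = ‖a‖ ^ 2 + ‖b‖ ^ 2 := by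
  have h := parallelogram_law_with_norm ℝ a b
  have h2 : ‖(Real.sqrt 2 : ℂ)‖ ^ 2 = 2 := by
    rw [Complex.norm_real, Real.norm_eq_abs, sq_abs, Real.sq_sqrt zero_le_two]
  rw [norm_div, norm_div, div_pow, div_pow, h2]
  linarith

theorem Gate.sum_norm_sq_apply (A : Oracle) (g : Gate n) (v : QState n) :
    ∑ y, ‖g.apply A v y‖ ^ 2 = ∑ y, ‖v y‖ ^ 2 := by
  cases g with
  | hadamard i =>
    have hflip : ∀ φ : (Fin n → Bool) → ℝ, ∑ y, φ (Function.update y i !(y i)) = ∑ y, φ y := by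
      intro φ
      have h := sum_comp_update_xor i (fun _ => true) (fun _ _ => rfl) φ
      simpa using h
    have h1 := hflip fun y => ‖(Gate.hadamard i).apply A v y‖ ^ 2
    have h2 := hflip fun y => ‖v y‖ ^ 2
    -- Summing over `y` together with its flip at `i` counts everything twice; on each such pair the
    -- claim is the parallelogram law.
    suffices h : ∑ y, (‖(Gate.hadamard i).apply A v y‖ ^ 2
        + ‖(Gate.hadamard i).apply A v (Function.update y i !(y i))‖ ^ 2) =
        ∑ y, (‖v y‖ ^ 2 + ‖v (Function.update y i !(y i))‖ ^ 2) by
      rw [Finset.sum_add_distrib, Finset.sum_add_distrib, h1, h2] at h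
      linarith
    refine Finset.sum_congr rfl fun y _ => ?_
    have key := hadamard_parallelogram (v (Function.update y i false)) (v (Function.update y i true))
    cases hy : y i
    · have h0 : Function.update y i false = y := by rw [← hy, Function.update_eq_self]
      simp only [Gate.apply, hy, Function.update_idem, Function.update_self, Bool.not_false,
        Bool.false_eq_true, if_false, if_true, one_mul, neg_one_mul, ← sub_eq_add_neg]
      rw [key, h0]
    · have h0 : Function.update y i true = y := by rw [← hy, Function.update_eq_self]
      simp only [Gate.apply, hy, Function.update_idem, Function.update_self, Bool.not_true,
        Bool.false_eq_true, if_false, if_true, one_mul, neg_one_mul, ← sub_eq_add_neg]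
      rw [add_comm, key, h0, add_comm]
  | phase i =>
    refine Finset.sum_congr rfl fun y _ => ?_
    simp only [Gate.apply, norm_mul]
    have h : Complex.I * (Real.pi / 4) = ((Real.pi / 4 : ℝ) : ℂ) * Complex.I := by
      push_cast; ring
    split
    · rw [h, Complex.norm_exp_ofReal_mul_I, one_mul]
    · simp
  | cnot c t h =>
    exact sum_comp_update_xor t (fun y => y c) (fun y b => Function.update_of_ne h b y)
      fun y => ‖v y‖ ^ 2
  | oracle q t h =>
    refine sum_comp_update_xor t (fun y => A (q.map y)) (fun y b => ?_) fun y => ‖v y‖ ^ 2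
    have h1 : q.map (Function.update y t b) = q.map y :=
      List.map_congr_left fun i hi => Function.update_of_ne
        (fun hit : i = t => (List.nodup_cons.1 h).1 (hit ▸ hi)) b y
    rw [h1]

theorem QCircuit.sum_norm_sq_eval (C : QCircuit) (A : Oracle) (v : QState (C.extra + 1)) :
    ∑ y, ‖C.eval A v y‖ ^ 2 = ∑ y, ‖v y‖ ^ 2 := by
  rw [QCircuit.eval]
  generalize C.gates = gs
  induction gs generalizing v with
  | nil => rfl
  | cons g gs ih => rw [List.foldl_cons, ih, g.sum_norm_sq_apply]

theorem QCircuit.acceptProb_nonneg (C : QCircuit) (A : Oracle) (v : QState (C.extra + 1)) :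
    0 ≤ C.acceptProb A v :=
  Finset.sum_nonneg fun y _ => by split <;> positivity

theorem QCircuit.acceptProb_le (C : QCircuit) (A : Oracle) (v : QState (C.extra + 1)) :
    C.acceptProb A v ≤ ∑ y, ‖v y‖ ^ 2 := by
  rw [← C.sum_norm_sq_eval A v]
  refine Finset.sum_le_sum fun y _ => ?_
  split
  · exact le_rfl
  · positivity

theorem Gate.apply_add (A : Oracle) (g : Gate n) (v w : QState n) :
    g.apply A (v + w) = g.apply A v + g.apply A w := by
  ext y
  cases g <;> simp only [Gate.apply, Pi.add_apply] <;> ring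

theorem Gate.apply_smul (A : Oracle) (g : Gate n) (c : ℂ) (v : QState n) :
    g.apply A (c • v) = c • g.apply A v := by
  ext y
  cases g <;> simp only [Gate.apply, Pi.smul_apply, smul_eq_mul] <;> ring

/-- A circuit as a linear map. -/
noncomputable def QCircuit.evalLinear (C : QCircuit) (A : Oracle) :
    QState (C.extra + 1) →ₗ[ℂ] QState (C.extra + 1) where
  toFun := C.eval A
  map_add' v w := by
    rw [QCircuit.eval, QCircuit.eval, QCircuit.eval]
    generalize C.gates = gs
    induction gs generalizing v w with
    | nil => rfl
    | cons g gs ih => rw [List.foldl_cons, g.apply_add, ih]; rfl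
  map_smul' c v := by
    rw [QCircuit.eval, QCircuit.eval]
    generalize C.gates = gs
    induction gs generalizing v with
    | nil => rfl
    | cons g gs ih => rw [List.foldl_cons, g.apply_smul, ih]; rfl

theorem sum_norm_sq_ket (x : List Bool) : ∑ y, ‖ket n x y‖ ^ 2 = 1 := by
  rw [Finset.sum_eq_single fun i : Fin n => x.getD i.val false]
  · simp [ket]
  · intro y _ hy
    have h : ¬ ∀ i : Fin n, y i = x.getD i.val false := fun h => hy (funext h)
    rw [ket, if_neg h, norm_zero, zero_pow two_ne_zero]
  · simp

end Circuits

/-! ## Size of uniform circuits -/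

theorem Machine.length_stk_step_le (M : Machine) (A : Oracle) (b : Bool) (c : M.Cfg)
    (i : Fin (M.work + 2)) : ((M.step A b c).stk i).length ≤ (c.stk i).length + 1 := by
  rw [Machine.step]
  split
  · rename_i j b' q _
    by_cases h : i = j
    · subst h; simp
    · simp [Function.update_of_ne h]
  · rename_i j q _
    by_cases h : i = j
    · subst h; simp; omega
    · simp [Function.update_of_ne h]
  all_goals exact Nat.le_succ _

theorem Machine.length_stk_run_le (M : Machine) (A : Oracle) (x : List Bool) {T : ℕ}
    (r : Fin T → Bool) : ((M.run A x r).stk 0).length ≤ x.length + T := by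
  have h : ∀ (l : List Bool) (c : M.Cfg),
      ((l.foldl (fun c b => M.step A b c) c).stk 0).length ≤ (c.stk 0).length + l.length := by
    intro l
    induction l with
    | nil => intro c; simp
    | cons b l ih =>
      intro c
      have h1 := ih (M.step A b c)
      have h2 := M.length_stk_step_le A b c 0
      simp only [List.foldl_cons, List.length_cons]
      omega
  simpa [Machine.run, Machine.start] using h (List.ofFn r) (M.start x)

theorem Gate.code_length_pos {n : ℕ} (g : Gate n) : 0 < g.code.length := by
  cases g <;> simp [Gate.code, unary]

theorem QCircuit.length_gates_le (C : QCircuit) : C.gates.length ≤ C.code.length := by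
  rw [QCircuit.code, List.length_append]
  have h : ∀ gs : List (Gate (C.extra + 1)), gs.length ≤ (gs.flatMap Gate.code).length := by
    intro gs
    induction gs with
    | nil => simp
    | cons g gs ih =>
      have := g.code_length_pos
      simp only [List.flatMap_cons, List.length_append, List.length_cons]
      omega
  exact (h _).trans (Nat.le_add_left _ _)

/-- A machine lengthens its output stack by at most one bit per step, and every gate has a nonempty
code. -/
theorem PolyTimeUniform.exists_length_gates_le {C : ℕ → QCircuit} (h : PolyTimeUniform C) :
    ∃ p : Polynomial ℕ, ∀ n, (C n).gates.length ≤ p.eval n := by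
  obtain ⟨M, p, -, hM⟩ := h
  refine ⟨Polynomial.X + p, fun n => (C n).length_gates_le.trans ?_⟩
  rw [← (hM n).2, Polynomial.eval_add, Polynomial.eval_X]
  refine (M.length_stk_run_le _ _ _).trans ?_
  simp

theorem PolyTimeUniform.isTest {C : ℕ → QCircuit} (h : PolyTimeUniform C) (σ : Polynomial ℕ) :
    IsTest (fun n A => (C n).acceptProb A (ket _ (List.replicate n true)))
      fun n => (2 ^ σ.eval n : ℝ)⁻¹ := by
  obtain ⟨p, hp⟩ := h.exists_length_gates_le
  refine ⟨fun n A => ⟨(C n).acceptProb_nonneg _ _,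
    ((C n).acceptProb_le _ _).trans (sum_norm_sq_ket _).le⟩,
    fun _ => inv_le_one_of_one_le₀ (one_le_pow₀ one_le_two), 2 * p, σ, fun n => ⟨?_, le_rfl⟩⟩
  refine degreeLE_mono ?_ ((C n).acceptProb_mem_degreeLE _)
  simpa using hp n

/-! ## Spectra of Hermitian matrices -/

section Spectrum

variable {ι : Type*} [Fintype ι] [DecidableEq ι] {E : Matrix ι ι ℂ}

theorem trace_pow_eq_sum_eigenvalues (hE : E.IsHermitian) (k : ℕ) :
    (E ^ k).trace = ((∑ i, hE.eigenvalues i ^ k : ℝ) : ℂ) := by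
  have h := hE.spectral_theorem
  conv_lhs => rw [h]
  rw [← map_pow, Unitary.conjStarAlgAut_apply, Matrix.trace_mul_cycle, Unitary.coe_star_mul_self,
    one_mul, Matrix.diagonal_pow, Matrix.trace_diagonal]
  simp

/-- In an eigenbasis the quadratic form at a unit vector is a weighted average of the eigenvalues,
so some eigenvalue is at least that value. -/
theorem exists_le_eigenvalue (hE : E.IsHermitian) {ψ : ι → ℂ} (hψ : ∑ i, ‖ψ i‖ ^ 2 = 1) {c : ℝ}
    (hc : c ≤ (star ψ ⬝ᵥ E *ᵥ ψ).re) : ∃ i, c ≤ hE.eigenvalues i := by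
  have hnorm : ∀ φ : ι → ℂ, star φ ⬝ᵥ φ = ((∑ i, ‖φ i‖ ^ 2 : ℝ) : ℂ) := fun φ => by
    simp only [dotProduct, Pi.star_apply, Complex.star_def, Complex.conj_mul']
    push_cast
    rfl
  set U : Matrix ι ι ℂ := ↑hE.eigenvectorUnitary with hU
  have hUU : U * star U = 1 := Unitary.coe_mul_star_self _
  set w := star U *ᵥ ψ with hw
  have hstar : ∀ z, star ψ ⬝ᵥ U *ᵥ z = star w ⬝ᵥ z := fun z => by
    rw [hw, Matrix.star_mulVec, Matrix.star_eq_conjTranspose, Matrix.conjTranspose_conjTranspose,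
      Matrix.dotProduct_mulVec]
  have hw1 : ∑ i, ‖w i‖ ^ 2 = 1 := by
    have h : star w ⬝ᵥ w = star ψ ⬝ᵥ ψ := by
      rw [← hstar, hw, Matrix.mulVec_mulVec, hUU, Matrix.one_mulVec]
    rw [hnorm, hnorm, hψ] at h
    exact_mod_cast h
  have hE' : (star ψ ⬝ᵥ E *ᵥ ψ).re = ∑ i, hE.eigenvalues i * ‖w i‖ ^ 2 := by
    have h := hE.spectral_theorem
    rw [Unitary.conjStarAlgAut_apply] at h
    have h2 : E *ᵥ ψ = U *ᵥ (Matrix.diagonal (RCLike.ofReal ∘ hE.eigenvalues) *ᵥ w) := by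
      conv_lhs => rw [h]
      rw [hw, Matrix.mulVec_mulVec, Matrix.mulVec_mulVec]
    rw [h2, hstar]
    simp only [dotProduct, Matrix.mulVec_diagonal, Complex.re_sum, Pi.star_apply,
      Function.comp_apply]
    refine Finset.sum_congr rfl fun i _ => ?_
    rw [mul_left_comm, Complex.star_def, Complex.conj_mul']
    refine (Complex.re_ofReal_mul _ _).trans ?_
    rw [← Complex.ofReal_pow, Complex.ofReal_re]
    rfl
  by_contra! hlt
  obtain ⟨i, -, hi⟩ : ∃ i ∈ Finset.univ, ‖w i‖ ^ 2 ≠ 0 :=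
    Finset.exists_ne_zero_of_sum_ne_zero (by rw [hw1]; exact one_ne_zero)
  have h3 : ∑ i, hE.eigenvalues i * ‖w i‖ ^ 2 < ∑ i, c * ‖w i‖ ^ 2 :=
    Finset.sum_lt_sum (fun j _ => mul_le_mul_of_nonneg_right (hlt j).le (by positivity))
      ⟨i, Finset.mem_univ i, mul_lt_mul_of_pos_right (hlt i) (by positivity)⟩
  rw [← Finset.mul_sum, hw1] at h3
  linarith

theorem exists_eigenvector_re_eq (hE : E.IsHermitian) (i : ι) :
    ∃ ψ : ι → ℂ, ∑ j, ‖ψ j‖ ^ 2 = 1 ∧ (star ψ ⬝ᵥ E *ᵥ ψ).re = hE.eigenvalues i := by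
  refine ⟨hE.eigenvectorBasis i, ?_, (hE.eigenvalues_eq i).symm⟩
  rw [← EuclideanSpace.norm_sq_eq, hE.eigenvectorBasis.orthonormal.1 i, one_pow]

end Spectrum

open Matrix

/-! ## The acceptance operator of a verifier -/

/-- The basis states of `n` qubits that are possible for the input `x` and a witness of `m`
qubits. -/
def WitnessIndex (n : ℕ) (x : List Bool) (m : ℕ) : Type :=
  {y : Fin n → Bool // ∀ i : Fin n,
    (∀ h : i.val < x.length, y i = x[i.val]) ∧ (x.length + m ≤ i.val → y i = false)}

noncomputable instance (n : ℕ) (x : List Bool) (m : ℕ) : Fintype (WitnessIndex n x m) :=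
  Fintype.ofInjective Subtype.val Subtype.val_injective

noncomputable instance (n : ℕ) (x : List Bool) (m : ℕ) : DecidableEq (WitnessIndex n x m) :=
  Classical.decEq _

/-- Only the `m` witness positions are free. This is an inequality because the circuit may have
fewer than `x.length + m` qubits; missing positions are read as `false`. -/
theorem card_witnessIndex_le (n : ℕ) (x : List Bool) (m : ℕ) :
    Fintype.card (WitnessIndex n x m) ≤ 2 ^ m := by
  have h : Fintype.card (Fin m → Bool) = 2 ^ m := by simp
  rw [← h]
  refine Fintype.card_le_of_injective
    (fun y j => if h : x.length + j.val < n then y.1 ⟨x.length + j.val, h⟩ else false) ?_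
  intro y z hyz
  refine Subtype.ext (funext fun i => ?_)
  rcases lt_or_ge i.val x.length with h1 | h1
  · rw [(y.2 i).1 h1, (z.2 i).1 h1]
  · rcases lt_or_ge i.val (x.length + m) with h2 | h2
    · have h3 := congrFun hyz ⟨i.val - x.length, by omega⟩
      have h4 : x.length + (i.val - x.length) = i.val := by omega
      simpa [h4] using h3
    · rw [(y.2 i).2 h2, (z.2 i).2 h2]

/-- The state with amplitudes `ψ` on the possible basis states. -/
noncomputable def witnessState {n : ℕ} {x : List Bool} {m : ℕ} (ψ : WitnessIndex n x m → ℂ) : QState n :=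
  fun y => ∑ j, if j.1 = y then ψ j else 0

section Verifier

variable {n : ℕ} {x : List Bool} {m : ℕ}

theorem witnessState_apply (ψ : WitnessIndex n x m → ℂ) (j : WitnessIndex n x m) :
    witnessState ψ j.1 = ψ j := by
  rw [witnessState, Finset.sum_eq_single j]
  · simp
  · intro k _ hk
    exact if_neg fun h => hk (Subtype.ext h)
  · simp

theorem exists_of_witnessState_ne_zero {ψ : WitnessIndex n x m → ℂ} {y : Fin n → Bool}
    (h : witnessState ψ y ≠ 0) : ∃ j : WitnessIndex n x m, j.1 = y := by
  obtain ⟨j, -, hj⟩ := Finset.exists_ne_zero_of_sum_ne_zero h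
  exact ⟨j, by by_contra hy; exact hj (if_neg hy)⟩

theorem sum_norm_sq_eq_of_support {v : QState n}
    (hv : ∀ y, v y ≠ 0 → ∃ j : WitnessIndex n x m, j.1 = y) :
    ∑ y, ‖v y‖ ^ 2 = ∑ j : WitnessIndex n x m, ‖v j.1‖ ^ 2 := by
  refine (Finset.sum_of_injOn (fun j : WitnessIndex n x m => j.1)
    (Subtype.val_injective.injOn) (by simp) ?_ fun _ _ => rfl).symm
  intro y _ hy
  by_cases h : v y = 0
  · simp [h]
  · obtain ⟨j, rfl⟩ := hv y h
    exact absurd ⟨j, by simp⟩ hy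

theorem isInitialState_witnessState {ψ : WitnessIndex n x m → ℂ} (hψ : ∑ j, ‖ψ j‖ ^ 2 = 1) :
    IsInitialState x m (witnessState ψ) := by
  refine ⟨?_, fun y hy => ?_⟩
  · rw [sum_norm_sq_eq_of_support fun y => exists_of_witnessState_ne_zero]
    simpa only [witnessState_apply] using hψ
  · obtain ⟨j, rfl⟩ := exists_of_witnessState_ne_zero hy
    exact j.2

theorem IsInitialState.exists_eq_witnessState {v : QState n} (hv : IsInitialState x m v) :
    ∃ ψ : WitnessIndex n x m → ℂ, ∑ j, ‖ψ j‖ ^ 2 = 1 ∧ v = witnessState ψ := by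
  have hs : ∀ y, v y ≠ 0 → ∃ j : WitnessIndex n x m, j.1 = y := fun y hy => ⟨⟨y, hv.2 y hy⟩, rfl⟩
  refine ⟨fun j => v j.1, (sum_norm_sq_eq_of_support hs).symm.trans hv.1, funext fun y => ?_⟩
  by_cases h : ∃ j : WitnessIndex n x m, j.1 = y
  · obtain ⟨j, rfl⟩ := h
    rw [witnessState_apply]
  · rw [not_not.1 fun hy => h (hs y hy)]
    exact (Finset.sum_eq_zero fun j _ => if_neg fun hj => h ⟨j, hj⟩).symm

end Verifier

/-- The accepting part of the final state as a function of the witness. -/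
noncomputable def acceptMatrix (C : QCircuit) (x : List Bool) (m : ℕ) (A : Oracle) :
    Matrix (Fin (C.extra + 1) → Bool) (WitnessIndex (C.extra + 1) x m) ℂ :=
  Matrix.of fun z j => (if z 0 = true then 1 else 0) * C.eval A (Pi.single j.1 1) z

/-- The acceptance operator of a verifier on the space of witnesses. -/
noncomputable def acceptOperator (C : QCircuit) (x : List Bool) (m : ℕ) (A : Oracle) :
    Matrix (WitnessIndex (C.extra + 1) x m) (WitnessIndex (C.extra + 1) x m) ℂ :=
  (acceptMatrix C x m A)ᴴ * acceptMatrix C x m A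

section AcceptOperator

variable (C : QCircuit) (x : List Bool) (m : ℕ) (A : Oracle)

theorem acceptOperator_isHermitian : (acceptOperator C x m A).IsHermitian :=
  Matrix.isHermitian_conjTranspose_mul_self _

theorem acceptMatrix_mulVec (ψ : WitnessIndex (C.extra + 1) x m → ℂ)
    (z : Fin (C.extra + 1) → Bool) :
    (acceptMatrix C x m A *ᵥ ψ) z =
      (if z 0 = true then 1 else 0) * C.eval A (witnessState ψ) z := by
  have h : witnessState ψ = ∑ j, ψ j • (Pi.single j.1 1 : QState (C.extra + 1)) := by
    ext y
    rw [witnessState, Finset.sum_apply]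
    refine Finset.sum_congr rfl fun j _ => ?_
    simp [Pi.single_apply, eq_comm]
  have h2 : C.eval A (witnessState ψ) = ∑ j, ψ j • C.eval A (Pi.single j.1 1) := by
    rw [h]
    exact (map_sum (C.evalLinear A) _ _).trans
      (Finset.sum_congr rfl fun j _ => map_smul (C.evalLinear A) _ _)
  rw [h2, Finset.sum_apply, Finset.mul_sum]
  refine Finset.sum_congr rfl fun j _ => ?_
  simp only [acceptMatrix, Matrix.of_apply, Pi.smul_apply, smul_eq_mul]
  ring

theorem acceptProb_witnessState (ψ : WitnessIndex (C.extra + 1) x m → ℂ) :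
    C.acceptProb A (witnessState ψ) = (star ψ ⬝ᵥ acceptOperator C x m A *ᵥ ψ).re := by
  rw [acceptOperator, ← Matrix.mulVec_mulVec, Matrix.dotProduct_mulVec, ← Matrix.star_mulVec,
    dotProduct, Complex.re_sum, QCircuit.acceptProb]
  refine Finset.sum_congr rfl fun z _ => ?_
  rw [Pi.star_apply, acceptMatrix_mulVec, ite_norm_sq_eq]
  split <;> simp

theorem eigenvalues_acceptOperator_nonneg (i : WitnessIndex (C.extra + 1) x m) :
    0 ≤ (acceptOperator_isHermitian C x m A).eigenvalues i :=
  Matrix.eigenvalues_conjTranspose_mul_self_nonneg _ i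

theorem eigenvalues_acceptOperator_le {c : ℝ}
    (h : ∀ v, IsInitialState x m v → C.acceptProb A v ≤ c) (i : WitnessIndex (C.extra + 1) x m) :
    (acceptOperator_isHermitian C x m A).eigenvalues i ≤ c := by
  obtain ⟨ψ, hψ, hi⟩ := exists_eigenvector_re_eq (acceptOperator_isHermitian C x m A) i
  rw [← hi, ← acceptProb_witnessState]
  exact h _ (isInitialState_witnessState hψ)

/-- The trace of the `k`-th power of the acceptance operator. -/
noncomputable def acceptTrace (k : ℕ) : ℝ := (acceptOperator C x m A ^ k).trace.re

theorem acceptTrace_eq_sum (k : ℕ) : acceptTrace C x m A k =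
    ∑ i, (acceptOperator_isHermitian C x m A).eigenvalues i ^ k := by
  rw [acceptTrace, trace_pow_eq_sum_eigenvalues (acceptOperator_isHermitian C x m A),
    Complex.ofReal_re]

theorem acceptTrace_nonneg (k : ℕ) : 0 ≤ acceptTrace C x m A k := by
  rw [acceptTrace_eq_sum]
  exact Finset.sum_nonneg fun i _ => pow_nonneg (eigenvalues_acceptOperator_nonneg C x m A i) k

variable {C x m A}

/-- Each of the at most `2 ^ m` eigenvalues is the acceptance probability of its eigenvector, a
legal witness. -/
theorem acceptTrace_le_of_forall {c : ℝ} (h : ∀ v, IsInitialState x m v → C.acceptProb A v ≤ c)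
    (hc : 0 ≤ c) (k : ℕ) : acceptTrace C x m A k ≤ 2 ^ m * c ^ k := by
  rw [acceptTrace_eq_sum]
  refine (Finset.sum_le_card_nsmul _ _ (c ^ k) fun i _ => pow_le_pow_left₀
    (eigenvalues_acceptOperator_nonneg C x m A i) (eigenvalues_acceptOperator_le C x m A h i) k).trans ?_
  rw [nsmul_eq_mul]
  refine mul_le_mul_of_nonneg_right ?_ (pow_nonneg hc k)
  exact_mod_cast card_witnessIndex_le (C.extra + 1) x m

/-- A good witness forces an eigenvalue of at least `c`, and the other eigenvalues are nonnegative.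
-/
theorem le_acceptTrace_of_exists {c : ℝ} (h : ∃ v, IsInitialState x m v ∧ c ≤ C.acceptProb A v)
    (hc : 0 ≤ c) (k : ℕ) : c ^ k ≤ acceptTrace C x m A k := by
  obtain ⟨v, hv, hcv⟩ := h
  obtain ⟨ψ, hψ, rfl⟩ := hv.exists_eq_witnessState
  rw [acceptProb_witnessState] at hcv
  obtain ⟨i, hi⟩ := exists_le_eigenvalue (acceptOperator_isHermitian C x m A) hψ hcv
  rw [acceptTrace_eq_sum]
  exact (pow_le_pow_left₀ hc hi k).trans (Finset.single_le_sum
    (f := fun i => (acceptOperator_isHermitian C x m A).eigenvalues i ^ k)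
    (fun j _ => pow_nonneg (eigenvalues_acceptOperator_nonneg C x m A j) k) (Finset.mem_univ i))

theorem acceptTrace_le (k : ℕ) : acceptTrace C x m A k ≤ 2 ^ m := by
  have h := acceptTrace_le_of_forall (C := C) (x := x) (m := m) (A := A) (c := 1)
    (fun v hv => (C.acceptProb_le A v).trans hv.1.le) zero_le_one k
  simpa using h

variable (C x m)

/-- Replacing the maximal acceptance probability over witnesses by a trace of a power is what keeps
it polynomial in the oracle bits; the degree grows only linearly in `k`. -/
theorem acceptTrace_mem_degreeLE (k : ℕ) :
    (fun A => acceptTrace C x m A k) ∈ degreeLE ℝ (2 * C.gates.length * k) := by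
  have hE : ∀ i j, (fun A => acceptOperator C x m A i j) ∈ degreeLE ℂ (2 * C.gates.length) := by
    intro i j
    have h1 : (fun A => acceptOperator C x m A i j) = ∑ z, (fun A =>
        star (acceptMatrix C x m A z i)) * fun A => acceptMatrix C x m A z j := by
      ext A
      simp only [acceptOperator, Matrix.mul_apply, Matrix.conjTranspose_apply, Finset.sum_apply,
        Pi.mul_apply]
    have h2 : ∀ z j, (fun A => acceptMatrix C x m A z j) ∈ degreeLE ℂ C.gates.length :=
      fun z j => Submodule.smul_mem _ _ (C.eval_mem_degreeLE _ z)
    rw [h1, two_mul]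
    exact sum_mem fun z _ => mul_mem_degreeLE (conj_mem_degreeLE (h2 z i)) (h2 z j)
  have hpow : ∀ i j, (fun A => (acceptOperator C x m A ^ k) i j)
      ∈ degreeLE ℂ (2 * C.gates.length * k) := by
    induction k with
    | zero =>
      intro i j
      simp only [pow_zero]
      exact const_mem_degreeLE _ _
    | succ k ih =>
      intro i j
      have h1 : (fun A => (acceptOperator C x m A ^ (k + 1)) i j) = ∑ l, (fun A =>
          (acceptOperator C x m A ^ k) i l) * fun A => acceptOperator C x m A l j := by
        ext A
        simp only [pow_succ, Matrix.mul_apply, Finset.sum_apply, Pi.mul_apply]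
      rw [h1, mul_add, mul_one]
      exact sum_mem fun l _ => mul_mem_degreeLE (ih i l) (hE l j)
  refine re_mem_degreeLE ?_
  have h1 : (fun A => (acceptOperator C x m A ^ k).trace) =
      ∑ i, fun A => (acceptOperator C x m A ^ k) i i := by
    ext A
    simp only [Matrix.trace, Matrix.diag_apply, Finset.sum_apply]
  rw [h1]
  exact sum_mem fun i _ => hpow i i

end AcceptOperator

/-! ## Pairs of verifiers -/

/-- The exponent for which the traces of the powers of the acceptance operators, for witnesses of
`m₀` and `m₁` qubits, separate the accepted from the rejected inputs. -/
def traceExponent (m₀ m₁ : ℕ) : ℕ := 3 * (m₀ + m₁ + 1)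

/-- The normalized product of the traces of powers of two acceptance operators. -/
noncomputable def pairTrace (C : Bool → QCircuit) (x : List Bool) (m : Bool → ℕ) (A : Oracle) : ℝ :=
  acceptTrace (C false) x (m false) A (traceExponent (m false) (m true))
    * acceptTrace (C true) x (m true) A (traceExponent (m false) (m true))
    / 2 ^ (m false + m true)

/-- The threshold for `pairTrace`. -/
noncomputable def pairThreshold (m : Bool → ℕ) : ℝ :=
  (4 / 9) ^ traceExponent (m false) (m true) / 2 ^ (m false + m true)

theorem le_pairTrace {C : Bool → QCircuit} {x : List Bool} {m : Bool → ℕ} {A : Oracle}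
    (h : ∀ b, ∃ v, IsInitialState x (m b) v ∧ 2 / 3 ≤ (C b).acceptProb A v) :
    pairThreshold m ≤ pairTrace C x m A := by
  rw [pairThreshold, pairTrace]
  gcongr
  rw [show (4 / 9 : ℝ) = 2 / 3 * (2 / 3) by norm_num, mul_pow]
  exact mul_le_mul (le_acceptTrace_of_exists (h false) (by norm_num) _)
    (le_acceptTrace_of_exists (h true) (by norm_num) _) (by positivity) (acceptTrace_nonneg ..)

/-- One rejecting verifier suffices: its trace is at most `2 ^ m * (1 / 3) ^ k`, the other at most
its dimension bound, while the threshold carries `(4 / 9) ^ k`. The ratio `(4 / 3) ^ k` beats the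
dimensions. -/
theorem pairTrace_le {C : Bool → QCircuit} {x : List Bool} {m : Bool → ℕ} {A : Oracle} (b : Bool)
    (h : ∀ v, IsInitialState x (m b) v → (C b).acceptProb A v ≤ 1 / 3) :
    pairTrace C x m A ≤ pairThreshold m / 2 := by
  rw [pairThreshold, pairTrace, div_right_comm]
  gcongr
  set k := traceExponent (m false) (m true) with hk
  have h1 := acceptTrace_le_of_forall h (by norm_num) k
  have h2 : acceptTrace (C false) x (m false) A k * acceptTrace (C true) x (m true) A k
      ≤ 2 ^ (m false + m true) * (1 / 3) ^ k := by
    rw [pow_add]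
    cases b
    · calc _ ≤ (2 ^ m false * (1 / 3) ^ k) * 2 ^ m true :=
          mul_le_mul h1 (acceptTrace_le k) (acceptTrace_nonneg ..) (by positivity)
        _ = _ := by ring
    · calc _ ≤ 2 ^ m false * (2 ^ m true * (1 / 3) ^ k) :=
          mul_le_mul (acceptTrace_le k) h1 (acceptTrace_nonneg ..) (by positivity)
        _ = _ := by ring
  refine h2.trans ?_
  -- The factor `3` in `traceExponent` enters through `(4 / 3) ^ 3 ≥ 2`.
  have h3 : (2 : ℝ) ^ (m false + m true + 1) ≤ (4 / 3) ^ k := by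
    rw [hk, traceExponent, pow_mul]
    exact pow_le_pow_left₀ (by norm_num) (by norm_num) _
  rw [le_div_iff₀ two_pos, show (4 / 9 : ℝ) = 4 / 3 * (1 / 3) by norm_num, mul_pow]
  rw [pow_succ] at h3
  have h4 : (0 : ℝ) < (1 / 3) ^ k := by positivity
  nlinarith

theorem isTest_pairTrace {C : Bool → ℕ → QCircuit} (hC : ∀ b, PolyTimeUniform (C b))
    (m : Bool → Polynomial ℕ) :
    IsTest (fun n A => pairTrace (fun b => C b n) (List.replicate n true) (fun b => (m b).eval n) A)
      fun n => pairThreshold fun b => (m b).eval n := by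
  choose p hp using fun b => (hC b).exists_length_gates_le
  set k : Polynomial ℕ := 3 * (m false + m true + 1) with hk
  have hkn : ∀ n, k.eval n = traceExponent ((m false).eval n) ((m true).eval n) := fun n => by
    simp [hk, traceExponent]
  refine ⟨fun n A => ⟨?_, ?_⟩, fun n => ?_, 2 * p false * k + 2 * p true * k,
    2 * k + (m false + m true), fun n => ⟨?_, ?_⟩⟩
  · exact div_nonneg (mul_nonneg (acceptTrace_nonneg ..) (acceptTrace_nonneg ..)) (by positivity)
  · beta_reduce
    rw [pairTrace, div_le_one (by positivity), pow_add]
    exact mul_le_mul (acceptTrace_le _) (acceptTrace_le _) (acceptTrace_nonneg ..) (by positivity)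
  · beta_reduce
    rw [pairThreshold, div_le_one (by positivity)]
    exact (pow_le_one₀ (by norm_num) (by norm_num)).trans (one_le_pow₀ one_le_two)
  · have h := mul_mem_degreeLE
      (acceptTrace_mem_degreeLE (C false n) (List.replicate n true) ((m false).eval n) (k.eval n))
      (acceptTrace_mem_degreeLE (C true n) (List.replicate n true) ((m true).eval n) (k.eval n))
    have h2 := Submodule.smul_mem _ (2 ^ ((m false).eval n + (m true).eval n) : ℝ)⁻¹ h
    have hle : 2 * (C false n).gates.length * k.eval n + 2 * (C true n).gates.length * k.eval n
        ≤ (2 * p false * k + 2 * p true * k).eval n := by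
      simp only [Polynomial.eval_add, Polynomial.eval_mul, Polynomial.eval_ofNat]
      gcongr
      · exact hp false n
      · exact hp true n
    convert degreeLE_mono hle h2 using 1
    ext A
    simp only [pairTrace, Pi.smul_apply, Pi.mul_apply, smul_eq_mul, hkn, div_eq_mul_inv]
    ring
  · beta_reduce
    rw [pairThreshold, ← hkn]
    simp only [Polynomial.eval_add, Polynomial.eval_mul, Polynomial.eval_ofNat]
    -- The term `2 * k` of the exponent comes from `4 / 9 ≥ 2 ^ (-2)`.
    rw [pow_add, mul_inv, pow_mul, ← inv_pow, div_eq_mul_inv]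
    gcongr
    norm_num

/-! ## The separations -/

theorem count_large_iff (A : Oracle) (n : ℕ) :
    (∀ b, 2 ^ n ≤ count A b n) ↔
      List.replicate n true ∈ countLanguage A false ⊓ countLanguage A true := by
  have h : ∀ b, List.replicate n true ∈ countLanguage A b ↔ 2 ^ n ≤ count A b n := fun b => by
    change 2 ^ (List.replicate n true).length ≤ count A b (List.replicate n true).length ↔ _
    rw [List.length_replicate]
  rw [Bool.forall_bool, ← h, ← h]
  rfl

/-- An oracle relative to which the intersection of the two count languages is hard. -/
theorem exists_hard_oracle : ∃ A : Oracle, (∀ n, PromiseAt A n) ∧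
    countLanguage A false ⊓ countLanguage A true ∉ SBQP A ∧
    ¬ (∀ b, countLanguage A b ∈ QMA A) ∧
    countLanguage A false ⊓ countLanguage A true ∉ SBP A := by
  let 𝒰 := {C : ℕ → QCircuit // PolyTimeUniform C}
  -- One countable index type for all adversaries: SBQP families, pairs of QMA verifiers, and SBP
  -- machines.
  let F : (𝒰 × Polynomial ℕ) ⊕ ((Bool → 𝒰) × (Bool → Polynomial ℕ)) ⊕
      (Machine × Polynomial ℕ × Polynomial ℕ) → (ℕ → Oracle → ℝ) × (ℕ → ℝ)
    | .inl (C, σ) => (fun n A => (C.1 n).acceptProb A (ket _ (List.replicate n true)),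
        fun n => (2 ^ σ.eval n : ℝ)⁻¹)
    | .inr (.inl (C, m)) => (fun n A => pairTrace (fun b => (C b).1 n) (List.replicate n true)
        (fun b => (m b).eval n) A, fun n => pairThreshold fun b => (m b).eval n)
    | .inr (.inr (M, p, σ)) => (fun n A => M.acceptProb A (List.replicate n true) (p.eval n),
        fun n => (2 ^ σ.eval n : ℝ)⁻¹)
  have hF : ∀ i, IsTest (F i).1 (F i).2 := by
    rintro (⟨C, σ⟩ | ⟨C, m⟩ | ⟨M, p, σ⟩)
    · exact C.2.isTest σ
    · exact isTest_pairTrace (fun b => (C b).2) m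
    · exact M.isTest p σ
  obtain ⟨A, hA, hsep⟩ := exists_oracle_forall_not_separates hF
  refine ⟨A, hA, ?_, ?_, ?_⟩
  · rintro ⟨C, σ, hC, h⟩
    obtain ⟨n, hn⟩ := hsep (.inl (⟨C, hC⟩, σ))
    have h := h (List.replicate n true)
    rw [List.length_replicate, ← count_large_iff] at h
    exact hn h
  · intro h
    choose C m hC h using h
    obtain ⟨n, hn⟩ := hsep (.inr (.inl (fun b => ⟨C b, hC b⟩, m)))
    -- The type of witness states depends on `x.length`; replacing `n` by `x.length` for a generic
    -- `x` avoids transport along `List.length_replicate`.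
    obtain ⟨x, hx, hn'⟩ : ∃ x, List.replicate n true = x ∧ n = x.length :=
      ⟨_, rfl, List.length_replicate.symm⟩
    have h := fun b => h b x
    have hc' := count_large_iff A n
    rw [hx] at hc'
    subst hn'
    have hs : Separates (pairTrace (fun b => C b x.length) (List.replicate x.length true)
        fun b => (m b).eval x.length) x.length (pairThreshold fun b => (m b).eval x.length) A := by
      rw [hx]
      refine ⟨fun hc => le_pairTrace fun b => ?_, fun hc => ?_⟩
      · have hmem := hc'.1 hc
        cases b
        · exact (h false).1 hmem.1
        · exact (h true).1 hmem.2
      · rw [hc'] at hc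
        by_cases h0 : x ∈ countLanguage A false
        · exact pairTrace_le true ((h true).2 fun h1 => hc ⟨h0, h1⟩)
        · exact pairTrace_le false ((h false).2 h0)
    exact hn hs
  · rintro ⟨M, p, σ, -, h⟩
    obtain ⟨n, hn⟩ := hsep (.inr (.inr (M, p, σ)))
    have h := h (List.replicate n true)
    rw [List.length_replicate, ← count_large_iff] at h
    exact hn h

end Relativized

theorem corollary3p4 :
    ∃ (A : Relativized.Oracle) (L₀ L₁ : Language Bool),
      L₀ ∈ Relativized.SBP A ∧ L₁ ∈ Relativized.SBP A ∧
      L₀ ⊓ L₁ ∉ Relativized.SBQP A ∧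
      ¬ Relativized.SBP A ⊆ Relativized.QMA A ∧
      ¬ (∀ K₀ ∈ Relativized.SBP A, ∀ K₁ ∈ Relativized.SBP A, K₀ ⊓ K₁ ∈ Relativized.SBP A) := by
  obtain ⟨A, hA, hSBQP, hQMA, hSBP⟩ := Relativized.exists_hard_oracle
  have hmem := Relativized.countLanguage_mem_SBP hA
  exact ⟨A, Relativized.countLanguage A false, Relativized.countLanguage A true, hmem false,
    hmem true, hSBQP, fun h => hQMA fun b => h (hmem b),
    fun h => hSBP (h _ (hmem false) _ (hmem true))⟩
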